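/- Let $k$ be a field and $R$ a commutative ring. A cyclic word over $R$ in $x_1,x_2,x_3$ is an element of $T_R/[T_R,T_R]$, where $T_R=R\langle x_1,x_2,x_3\rangle$ is the free associative algebra and $[T_R,T_R]$ is the $R$-span of the commutators. The cyclic derivative $\partial/\partial x_i\colon T_R/[T_R,T_R]\to T_R$ is the $R$-linear map that sends a word $w$ to $\sum_{w=u x_i v} v u$ (sum over all occurrences of $x_i$ in $w$). For a cyclic word $\Phi$ over $R$ let $\mathscr U(\Phi)$ be the quotient of $T_R$ by the two-sided ideal generated by $$r_1=[x_2,x_3]-\tfrac{\partial\Phi}{\partial x_1},\quad r_2=[x_3,x_1]-\tfrac{\partial\Phi}{\partial x_2},\quad r_3=[x_1,x_2]-\tfrac{\partial\Phi}{\partial x_3}.$$ Let $\Phi_\hbar=\hbar\Phi_1+\hbar^2\Phi_2+\dots+\hbar^N\Phi_N$, where $\Phi_1,\dots,\Phi_N$ are arbitrary (possibly non-homogeneous) cyclic words over $k$; let $A=\mathscr U_\hbar(\Phi_\hbar)$ be the algebra $\mathscr U(\Phi_\hbar)$ formed over $R=k[\hbar]$, and for $a\in k$ let $\Phi(a)=\sum_m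 a^m\Phi_m$ and $A_a=A\otimes_{k[\hbar]}k[\hbar]/(\hbar-a)$. Write $S(V)=k[x_1,x_2,x_3]$ and $S^\ell(V)$ for its part of degree $\ell$. Then: 1. Let $T=T_{k[\hbar]}$ and let $d\colon\bigoplus_i T\otimes_{k[\hbar]}k[\hbar]\xi_i\otimes_{k[\hbar]} T\to T$ be the $T$-bimodule map with $d(\xi_i)=r_i$ (for $\Phi=\Phi_\hbar$), where $\xi_1=\xi_{23}$, $\xi_2=\xi_{31}$, $\xi_3=\xi_{12}$. With the unperturbed $d(\xi_{123})=\sum_i(\xi_i x_i-x_i\xi_i)$ one has $d(d(\xi_{123}))=\sum_i[r_i,x_i]=0$. 2. $A$ has the PBW property for the descending filtration $\Gamma_\ell=\hbar^\ell A$: there is an isomorphism of graded $k[\hbar]$-algebras $\bigoplus_{\ell\ge0}\Gamma_\ell/\Gamma_{\ell+1}\simeq S(V)[\hbar]$ (where $\hbar$ acts on the left as its class in $\Gamma_1/\Gamma_2$) that identifies $\Gamma_\ell/\Gamma_{\ell+1}$ with $\hbar^\ell S(V)$ and sends the class of $x_i$ in $\Gamma_0/\Gamma_1$ to $x_i$.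 3. For every $a\in k$ there is an isomorphism of $k$-algebras $A_a\simeq\mathscr U(\Phi(a))$ that sends $x_i$ to $x_i$. 4. Suppose that all $\partial\Phi_\hbar/\partial x_i$ have degree at most $2$ in $x_1,x_2,x_3$ (for example, that all $\Phi_m$ have degree at most $3$). Then for all but countably many $a\in k$ the algebra $A_a\simeq\mathscr U(\Phi(a))$ has the PBW property for the ascending filtration: if $F_\ell$ is the span of the monomials of degree at most $\ell$ in $x_1,x_2,x_3$ and $F_{-1}=0$, then there is an isomorphism of graded vector spaces $\bigoplus_{\ell\ge0}F_\ell/F_{\ell-1}\simeq S(V)$, with $F_\ell/F_{\ell-1}\simeq S^\ell(V)$, which sends the class of each ordered monomial $x_1^{\alpha_1}x_2^{\alpha_2}x_3^{\alpha_3}$ to the corresponding commutative monomial, and which is an isomorphism of algebras whenever $\bigoplus_{\ell}F_\ell/F_{\ell-1}$ is commutative. -/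

import Mathlib

open scoped TensorProduct DirectSum
open Polynomial

noncomputable section

namespace CyclicPotential

/-! ### Associated graded algebra of a filtration -/

/-- An algebra filtration of `A` by `R`-submodules `F n`, together with the neighbouring smaller
step `G n` (so `G n = F (n - 1)` for an ascending filtration and `G n = F (n + 1)` for a descending
one). The associated graded algebra is `⨁ n, F n / G n`. -/
structure AlgFiltration (R : Type*) [CommRing R] (A : Type*) [Ring A] [Algebra R A] where
  F : ℕ → Submodule R A
  G : ℕ → Submodule R A
  G_le : ∀ n, G n ≤ F n
  one_mem : (1 : A) ∈ F 0
  mul_mem : ∀ {i j : ℕ} {a b : A}, a ∈ F i → b ∈ F j → a * b ∈ F (i + j)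
  mul_G : ∀ {i j : ℕ} {a b : A}, a ∈ F i → b ∈ G j → a * b ∈ G (i + j)
  G_mul : ∀ {i j : ℕ} {a b : A}, a ∈ G i → b ∈ F j → a * b ∈ G (i + j)

namespace AlgFiltration

variable {R : Type*} [CommRing R] {A : Type*} [Ring A] [Algebra R A] (T : AlgFiltration R A)

/-- The graded piece `F n / G n`. -/
def Piece (n : ℕ) : Type _ := T.F n ⧸ (T.G n).submoduleOf (T.F n)

instance (n : ℕ) : AddCommGroup (T.Piece n) :=
  inferInstanceAs (AddCommGroup (T.F n ⧸ (T.G n).submoduleOf (T.F n)))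

instance (n : ℕ) : Module R (T.Piece n) :=
  inferInstanceAs (Module R (T.F n ⧸ (T.G n).submoduleOf (T.F n)))

/-- The class in `F n / G n` of an element of `F n`. -/
def cls (n : ℕ) (a : A) (h : a ∈ T.F n) : T.Piece n := Submodule.Quotient.mk ⟨a, h⟩

theorem cls_eq_iff {n : ℕ} {a b : A} (ha : a ∈ T.F n) (hb : b ∈ T.F n) :
    T.cls n a ha = T.cls n b hb ↔ a - b ∈ T.G n :=
  Submodule.Quotient.eq (x := (⟨a, ha⟩ : T.F n)) (y := ⟨b, hb⟩) _

theorem exists_cls {n : ℕ} (u : T.Piece n) : ∃ a h, u = T.cls n a h := by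
  induction u using Submodule.Quotient.induction_on with
  | H z => exact ⟨z.1, z.2, rfl⟩

/-- The product of graded pieces, induced by the product of `A`. -/
def pieceMul {i j : ℕ} (u : T.Piece i) (v : T.Piece j) : T.Piece (i + j) :=
  Quotient.liftOn₂' u v (fun a b => T.cls (i + j) (a * b : A) (T.mul_mem a.2 b.2)) (by
    intro a b a' b' ha hb
    have ha' : (a - a' : A) ∈ T.G i := (T.cls_eq_iff a.2 a'.2).1 (Quotient.sound' ha)
    have hb' : (b - b' : A) ∈ T.G j := (T.cls_eq_iff b.2 b'.2).1 (Quotient.sound' hb)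
    refine (T.cls_eq_iff _ _).2 ?_
    have h : (a * b - a' * b' : A) = (a - a') * b + a' * (b - b') := by noncomm_ring
    rw [h]
    exact add_mem (T.G_mul ha' b.2) (T.mul_G a'.2 hb'))

theorem pieceMul_cls {i j : ℕ} {a b : A} (ha : a ∈ T.F i) (hb : b ∈ T.F j) :
    T.pieceMul (T.cls i a ha) (T.cls j b hb) = T.cls (i + j) (a * b) (T.mul_mem ha hb) := rfl

theorem mk_cls_eq {i j : ℕ} (hij : i = j) {a b : A} (ha : a ∈ T.F i) (hb : b ∈ T.F j)
    (hab : a = b) :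
    GradedMonoid.mk (A := T.Piece) i (T.cls i a ha) = GradedMonoid.mk j (T.cls j b hb) := by
  subst hij; subst hab; rfl

instance : GradedMonoid.GMul T.Piece := ⟨fun u v => T.pieceMul u v⟩

instance : GradedMonoid.GOne T.Piece := ⟨T.cls 0 1 T.one_mem⟩

instance : DirectSum.GRing T.Piece where
  mul_zero {i j} u := by
    obtain ⟨a, ha, rfl⟩ := T.exists_cls u
    exact (T.cls_eq_iff (T.mul_mem ha (zero_mem _)) (zero_mem _)).2 (by simp)
  zero_mul {i j} u := by
    obtain ⟨a, ha, rfl⟩ := T.exists_cls u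
    exact (T.cls_eq_iff (T.mul_mem (zero_mem _) ha) (zero_mem _)).2 (by simp)
  mul_add {i j} u v w := by
    obtain ⟨a, ha, rfl⟩ := T.exists_cls u
    obtain ⟨b, hb, rfl⟩ := T.exists_cls v
    obtain ⟨c, hc, rfl⟩ := T.exists_cls w
    exact (T.cls_eq_iff (T.mul_mem ha (add_mem hb hc))
      (add_mem (T.mul_mem ha hb) (T.mul_mem ha hc))).2 (by simp [mul_add])
  add_mul {i j} u v w := by
    obtain ⟨a, ha, rfl⟩ := T.exists_cls u
    obtain ⟨b, hb, rfl⟩ := T.exists_cls v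
    obtain ⟨c, hc, rfl⟩ := T.exists_cls w
    exact (T.cls_eq_iff (T.mul_mem (add_mem ha hb) hc)
      (add_mem (T.mul_mem ha hc) (T.mul_mem hb hc))).2 (by simp [add_mul])
  one_mul := by
    rintro ⟨i, u⟩
    obtain ⟨a, ha, rfl⟩ := T.exists_cls u
    exact T.mk_cls_eq (zero_add i) _ _ (one_mul a)
  mul_one := by
    rintro ⟨i, u⟩
    obtain ⟨a, ha, rfl⟩ := T.exists_cls u
    exact T.mk_cls_eq (add_zero i) _ _ (mul_one a)
  mul_assoc := by
    rintro ⟨i, u⟩ ⟨j, v⟩ ⟨l, w⟩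
    obtain ⟨a, ha, rfl⟩ := T.exists_cls u
    obtain ⟨b, hb, rfl⟩ := T.exists_cls v
    obtain ⟨c, hc, rfl⟩ := T.exists_cls w
    exact T.mk_cls_eq (add_assoc i j l) _ _ (mul_assoc a b c)
  natCast n := n • T.cls 0 1 T.one_mem
  natCast_zero := zero_smul _ _
  natCast_succ n := succ_nsmul _ n
  intCast n := n • T.cls 0 1 T.one_mem
  intCast_ofNat n := natCast_zsmul _ n
  intCast_negSucc_ofNat n := negSucc_zsmul _ n

instance : DirectSum.GAlgebra R T.Piece where
  toFun :=
    { toFun := fun r => r • T.cls 0 1 T.one_mem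
      map_zero' := zero_smul _ _
      map_add' := fun r s => add_smul r s _ }
  map_one := one_smul _ _
  map_mul r s := T.mk_cls_eq (zero_add 0).symm (Submodule.smul_mem _ _ T.one_mem)
    (T.mul_mem (Submodule.smul_mem _ _ T.one_mem) (Submodule.smul_mem _ _ T.one_mem))
    (by simp [mul_smul, smul_comm r s])
  commutes r := by
    rintro ⟨i, u⟩
    obtain ⟨a, ha, rfl⟩ := T.exists_cls u
    exact T.mk_cls_eq (add_comm 0 i) (T.mul_mem (Submodule.smul_mem _ r T.one_mem) ha)
      (T.mul_mem ha (Submodule.smul_mem _ r T.one_mem)) (by simp)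
  smul_def r := by
    rintro ⟨i, u⟩
    obtain ⟨a, ha, rfl⟩ := T.exists_cls u
    exact T.mk_cls_eq (zero_add i).symm (Submodule.smul_mem _ r ha)
      (T.mul_mem (Submodule.smul_mem _ r T.one_mem) ha) (by simp)

/-- The associated graded algebra `⨁ n, F n / G n`. -/
abbrev Gr : Type _ := ⨁ n, T.Piece n

/-- The homogeneous element of degree `n` of the associated graded algebra that is represented by
`a ∈ F n`. -/
def symb (n : ℕ) (a : A) (h : a ∈ T.F n) : T.Gr := DirectSum.of T.Piece n (T.cls n a h)

end AlgFiltration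

/-! ### The ascending filtration by degree in the generators -/

section Ascending

variable (R : Type*) [CommRing R] {A : Type*} [Ring A] [Algebra R A] {n : ℕ} (x : Fin n → A)

/-- The span of all products of at most `d` of the elements `x i`. -/
def wordSpan (d : ℕ) : Submodule R A :=
  Submodule.span R {a | ∃ w : List (Fin n), w.length ≤ d ∧ (w.map x).prod = a}

theorem wordSpan_mono {d e : ℕ} (h : d ≤ e) : wordSpan R x d ≤ wordSpan R x e :=
  Submodule.span_mono fun _ ⟨w, hw, hwa⟩ => ⟨w, hw.trans h, hwa⟩

theorem one_mem_wordSpan : (1 : A) ∈ wordSpan R x 0 :=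
  Submodule.subset_span ⟨[], by simp, by simp⟩

theorem mul_mem_wordSpan {d e : ℕ} {a b : A} (ha : a ∈ wordSpan R x d)
    (hb : b ∈ wordSpan R x e) : a * b ∈ wordSpan R x (d + e) := by
  have h := Submodule.mul_mem_mul ha hb
  rw [wordSpan, wordSpan, Submodule.span_mul_span] at h
  refine Submodule.span_mono ?_ h
  rintro _ ⟨_, ⟨v, hv, rfl⟩, _, ⟨w, hw, rfl⟩, rfl⟩
  exact ⟨v ++ w, by simp; omega, by simp⟩

/-- The step of degree `d - 1` of the filtration, which is `0` for `d = 0`. -/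
def wordSpanPred : ℕ → Submodule R A
  | 0 => ⊥
  | d + 1 => wordSpan R x d

/-- The ascending filtration `F_d`, spanned by the monomials of degree at most `d` in the
generators `x i`. -/
def degreeFiltration : AlgFiltration R A where
  F := wordSpan R x
  G := wordSpanPred R x
  G_le
    | 0 => bot_le
    | d + 1 => wordSpan_mono R x d.le_succ
  one_mem := one_mem_wordSpan R x
  mul_mem := mul_mem_wordSpan R x
  mul_G {i j a b} ha hb := by
    cases j with
    | zero =>
      rw [(Submodule.mem_bot R).1 hb, mul_zero]
      exact zero_mem _
    | succ j => exact mul_mem_wordSpan R x ha hb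
  G_mul {i j a b} ha hb := by
    cases i with
    | zero =>
      rw [(Submodule.mem_bot R).1 ha, zero_mul]
      exact zero_mem _
    | succ i =>
      have h := mul_mem_wordSpan R x ha hb
      rw [Nat.add_right_comm]
      exact h

/-- The ordered monomial `x_0 ^ α_0 * x_1 ^ α_1 * ⋯`. -/
def orderedMonomial (α : Fin n →₀ ℕ) : A :=
  ((List.finRange n).map fun i => x i ^ α i).prod

theorem orderedMonomial_mem (α : Fin n →₀ ℕ) : orderedMonomial x α ∈ wordSpan R x α.degree := by
  refine Submodule.subset_span
    ⟨(List.finRange n).flatMap fun i => List.replicate (α i) i, ?_, ?_⟩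
  · rw [List.length_flatMap, Finsupp.degree_eq_sum]
    simp [Fin.sum_univ_def]
  · rw [orderedMonomial, List.map_flatMap]
    generalize List.finRange n = l
    induction l with
    | nil => simp
    | cons i l ih =>
      rw [List.flatMap_cons, List.prod_append, List.map_cons, List.prod_cons, ih]
      simp

/-- The Poincaré-Birkhoff-Witt property of the algebra `A` with generators `x i` (subject to
relations of degree at most two): the associated graded algebra of the ascending filtration is, as
a graded `R`-module, the polynomial algebra, in such a way that each ordered monomial corresponds to
its commutative counterpart; and this is an isomorphism of algebras as soon as the associated graded
algebra is commutative. (If the relations have quadratic corrections, then the associated graded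
algebra need not be commutative.) -/
def IsPBW : Prop :=
  ∃ e : (degreeFiltration R x).Gr ≃ₗ[R] MvPolynomial (Fin n) R,
    (∀ d u, (e (DirectSum.of (degreeFiltration R x).Piece d u)).IsHomogeneous d) ∧
    (∀ α : Fin n →₀ ℕ,
      e ((degreeFiltration R x).symb α.degree (orderedMonomial x α) (orderedMonomial_mem R x α)) =
        MvPolynomial.monomial α 1) ∧
    ((∀ u v : (degreeFiltration R x).Gr, u * v = v * u) → ∀ u v, e (u * v) = e u * e v)

end Ascending

/-! ### The descending filtration by powers of the parameter -/

section Descending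

variable (k : Type*) [Field k] {A : Type*} [Ring A] [Algebra k A] [Algebra k[X] A]

/-- The descending filtration `Γ_l = ħ ^ l A` of a `k[ħ]`-algebra, by `k`-subspaces. -/
def hbarFiltration : AlgFiltration k A where
  F l := LinearMap.range (LinearMap.mulLeft k (algebraMap k[X] A X ^ l))
  G l := LinearMap.range (LinearMap.mulLeft k (algebraMap k[X] A X ^ (l + 1)))
  G_le l := by
    rintro _ ⟨b, rfl⟩
    exact ⟨algebraMap k[X] A X * b, by simp [pow_succ]⟩
  one_mem := ⟨1, by simp⟩
  mul_mem := by
    rintro i j _ _ ⟨a, rfl⟩ ⟨b, rfl⟩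
    refine ⟨a * b, ?_⟩
    have h := (Algebra.commutes (R := k[X]) (X ^ j) a)
    rw [map_pow] at h
    simp only [LinearMap.mulLeft_apply, pow_add, mul_assoc]
    rw [← mul_assoc a, ← h, mul_assoc]
  mul_G := by
    rintro i j _ _ ⟨a, rfl⟩ ⟨b, rfl⟩
    refine ⟨a * b, ?_⟩
    have h := (Algebra.commutes (R := k[X]) (X ^ (j + 1)) a)
    rw [map_pow] at h
    simp only [LinearMap.mulLeft_apply, add_assoc, pow_add _ i, mul_assoc]
    rw [← mul_assoc a, ← h, mul_assoc]
  G_mul := by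
    rintro i j _ _ ⟨a, rfl⟩ ⟨b, rfl⟩
    refine ⟨a * b, ?_⟩
    have h := (Algebra.commutes (R := k[X]) (X ^ j) a)
    rw [map_pow] at h
    simp only [LinearMap.mulLeft_apply, Nat.add_right_comm i j 1, pow_add _ (i + 1), mul_assoc]
    rw [← mul_assoc a, ← h, mul_assoc]

theorem hbar_mem : algebraMap k[X] A X ∈ (hbarFiltration k (A := A)).F 1 := ⟨1, by simp⟩

theorem mem_hbar_zero (a : A) : a ∈ (hbarFiltration k (A := A)).F 0 := ⟨a, by simp⟩

/-- The PBW property for the descending filtration `Γ_l = ħ ^ l A`: there is a graded isomorphism of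
`k[ħ]`-algebras `⨁ l, Γ_l / Γ_{l + 1} ≃ S(V)[ħ]`, where `Γ_l / Γ_{l + 1}` corresponds to
`ħ ^ l S(V)`, and the class of the generator `x i` to the variable `x_i`. The parameter `ħ` acts on
the left-hand side as the class of `ħ` in `Γ_1 / Γ_2`. -/
def IsDescendingPBW {n : ℕ} (x : Fin n → A) : Prop :=
  ∃ e : (hbarFiltration k (A := A)).Gr ≃ₐ[k] (MvPolynomial (Fin n) k)[X],
    (∀ l u, ∃ p, e (DirectSum.of (hbarFiltration k (A := A)).Piece l u) = monomial l p) ∧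
    e ((hbarFiltration k).symb 1 (algebraMap k[X] A X) (hbar_mem k)) = X ∧
    ∀ i, e ((hbarFiltration k).symb 0 (x i) (mem_hbar_zero k (x i))) = C (MvPolynomial.X i)

end Descending

/-! ### Cyclic words and their derivatives -/

section Cyclic

variable (R : Type*) [CommRing R] {n : ℕ}

/-- The subspace `[T, T]` of the free algebra `T` spanned by all commutators. -/
def commutators (n : ℕ) : Submodule R (FreeAlgebra R (Fin n)) :=
  Submodule.span R {c | ∃ a b, a * b - b * a = c}

/-- The space `T / [T, T]` of cyclic words in `n` variables. -/
abbrev CyclicWord (n : ℕ) : Type _ := FreeAlgebra R (Fin n) ⧸ commutators R n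

/-- The word `w` as a monomial of the free algebra. -/
def word (w : List (Fin n)) : FreeAlgebra R (Fin n) := (w.map (FreeAlgebra.ι R)).prod

/-- The contribution of the position `j` to the cyclic derivative of the word `w` by the `i`-th
variable: if the letter at the position `j` is `i`, remove it and cut the cyclic word there. -/
def cutAt (i : Fin n) (w : List (Fin n)) (j : ℕ) : FreeAlgebra R (Fin n) :=
  if w[j]? = some i then word R (w.drop (j + 1) ++ w.take j) else 0

/-- The linear map on the free algebra that sends each word `w` to the sum, over all occurrences of
the `i`-th variable in `w`, of the cyclic word `w` cut open at this occurrence. -/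
def wordDeriv (i : Fin n) : FreeAlgebra R (Fin n) →ₗ[R] FreeAlgebra R (Fin n) :=
  (FreeAlgebra.basisFreeMonoid R (Fin n)).constr R fun w =>
    ∑ j ∈ Finset.range w.toList.length, cutAt R i w.toList j

theorem basis_eq_word (w : FreeMonoid (Fin n)) :
    FreeAlgebra.basisFreeMonoid R (Fin n) w = word R w.toList := by
  simp [FreeAlgebra.basisFreeMonoid, FreeAlgebra.equivMonoidAlgebraFreeMonoid, word,
    FreeMonoid.lift_apply]

theorem wordDeriv_word (i : Fin n) (w : List (Fin n)) :
    wordDeriv R i (word R w) = ∑ j ∈ Finset.range w.length, cutAt R i w j := by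
  have h := (FreeAlgebra.basisFreeMonoid R (Fin n)).constr_basis R
    (fun w => ∑ j ∈ Finset.range w.toList.length, cutAt R i w.toList j) (FreeMonoid.ofList w)
  rw [basis_eq_word] at h
  exact h

theorem wordDeriv_append (i : Fin n) (v w : List (Fin n)) :
    wordDeriv R i (word R (v ++ w)) = wordDeriv R i (word R (w ++ v)) := by
  have key : ∀ v w : List (Fin n), (∑ j ∈ Finset.range (v ++ w).length, cutAt R i (v ++ w) j) =
      (∑ j ∈ Finset.range v.length,
        if v[j]? = some i then word R (v.drop (j + 1) ++ w ++ v.take j) else 0) +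
      ∑ j ∈ Finset.range w.length,
        if w[j]? = some i then word R (w.drop (j + 1) ++ v ++ w.take j) else 0 := by
    intro v w
    rw [List.length_append, Finset.sum_range_add]
    congr 1
    · refine Finset.sum_congr rfl fun j hj => ?_
      have hj := Finset.mem_range.1 hj
      rw [cutAt, List.getElem?_append_left hj, List.drop_append_of_le_length (by omega),
        List.take_append_of_le_length (by omega)]
    · refine Finset.sum_congr rfl fun j hj => ?_
      rw [cutAt, List.getElem?_append_right (by omega), List.take_append, List.drop_append]
      simp [add_assoc, List.take_of_length_le, List.drop_of_length_le]
  rw [wordDeriv_word, wordDeriv_word, key v w, key w v, add_comm]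

theorem wordDeriv_mul_comm (i : Fin n) (a b : FreeAlgebra R (Fin n)) :
    wordDeriv R i (a * b) = wordDeriv R i (b * a) := by
  have h : (LinearMap.mul R (FreeAlgebra R (Fin n))).compr₂ (wordDeriv R i) =
      (LinearMap.mul R (FreeAlgebra R (Fin n))).flip.compr₂ (wordDeriv R i) := by
    refine (FreeAlgebra.basisFreeMonoid R (Fin n)).ext fun v =>
      (FreeAlgebra.basisFreeMonoid R (Fin n)).ext fun w => ?_
    have := wordDeriv_append R i v.toList w.toList
    simpa [basis_eq_word, word] using this
  exact LinearMap.congr_fun (LinearMap.congr_fun h a) b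

/-- The cyclic derivative `∂/∂x_i` of cyclic words. -/
def cyclicDeriv (i : Fin n) : CyclicWord R n →ₗ[R] FreeAlgebra R (Fin n) :=
  (commutators R n).liftQ (wordDeriv R i) (by
    rw [commutators, Submodule.span_le]
    rintro _ ⟨a, b, rfl⟩
    simp [wordDeriv_mul_comm R i a b])

/-- Extension of the coefficients of a cyclic word from `k` to `k[ħ]`. -/
def coeffExtend (k : Type*) [Field k] (n : ℕ) : CyclicWord k n →+ CyclicWord k[X] n :=
  QuotientAddGroup.map (commutators k n).toAddSubgroup (commutators k[X] n).toAddSubgroup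
    (FreeAlgebra.lift k (FreeAlgebra.ι k[X]) :
      FreeAlgebra k (Fin n) →ₐ[k] FreeAlgebra k[X] (Fin n)).toLinearMap.toAddMonoidHom (by
    have h : commutators k n ≤ ((commutators k[X] n).restrictScalars k).comap
        (FreeAlgebra.lift k (FreeAlgebra.ι k[X]) :
          FreeAlgebra k (Fin n) →ₐ[k] FreeAlgebra k[X] (Fin n)).toLinearMap := by
      rw [commutators, Submodule.span_le]
      rintro _ ⟨a, b, rfl⟩
      exact Submodule.subset_span ⟨FreeAlgebra.lift k (FreeAlgebra.ι k[X]) a,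
        FreeAlgebra.lift k (FreeAlgebra.ι k[X]) b, by simp⟩
    exact h)

end Cyclic

/-! ### Algebras with cyclic potential -/

section Algebras

variable (R : Type*) [CommRing R] (Φ : CyclicWord R 3)

/-- The defining elements `[y, z] - ∂Φ/∂x`, `[z, x] - ∂Φ/∂y`, `[x, y] - ∂Φ/∂z` for `i = 0, 1, 2`
(indices are taken modulo three). -/
def relator (i : Fin 3) : FreeAlgebra R (Fin 3) :=
  FreeAlgebra.ι R (i + 1) * FreeAlgebra.ι R (i + 2)
    - FreeAlgebra.ι R (i + 2) * FreeAlgebra.ι R (i + 1) - cyclicDeriv R i Φ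

/-- The algebra `U(Φ)` over `R`: the quotient of the free algebra in three variables by the
two-sided ideal generated by the defining elements. -/
abbrev PotentialAlgebra : Type _ :=
  RingQuot fun a b : FreeAlgebra R (Fin 3) => (∃ i, a = relator R Φ i) ∧ b = 0

/-- The generators of `U(Φ)`. -/
def gen (i : Fin 3) : PotentialAlgebra R Φ := RingQuot.mkAlgHom R _ (FreeAlgebra.ι R i)

open TensorProduct in
/-- The degree `-1` differential `d` of the perturbed Koszul resolution. Its source
`⨁ i, T ⊗ ξ_i ⊗ T` is the free bimodule on `ξ_0 = ξ_23`, `ξ_1 = ξ_31`, `ξ_2 = ξ_12`, and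
`d(a ξ_i b) = a r_i b`, where `r_i` is the `i`-th defining element. -/
def koszulD : (Fin 3 → FreeAlgebra R (Fin 3) ⊗[R] FreeAlgebra R (Fin 3)) →ₗ[R]
    FreeAlgebra R (Fin 3) :=
  LinearMap.lsum R _ R fun i =>
    TensorProduct.lift ((LinearMap.mul R _).compl₁₂ (LinearMap.mulRight R (relator R Φ i))
      LinearMap.id)

/-- The unperturbed differential `d(ξ_123) = [ξ_12, x_3] + [ξ_23, x_1] + [ξ_31, x_2]`, whose
component at `ξ_i` is `ξ_i x_i - x_i ξ_i`. -/
def koszulXi : Fin 3 → FreeAlgebra R (Fin 3) ⊗[R] FreeAlgebra R (Fin 3) :=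
  fun i => 1 ⊗ₜ FreeAlgebra.ι R i - FreeAlgebra.ι R i ⊗ₜ 1

end Algebras

section Potential

variable {k : Type*} [Field k] (N : ℕ) (Φ : ℕ → CyclicWord k 3)

/-- The cyclic potential `Φ_ħ = ħ Φ_1 + ħ² Φ_2 + ⋯ + ħ^N Φ_N`. -/
def hbarPotential : CyclicWord k[X] 3 :=
  ∑ m ∈ Finset.Icc 1 N, (X : k[X]) ^ m • coeffExtend k 3 (Φ m)

/-- The value `Φ(a) = a Φ_1 + a² Φ_2 + ⋯ + a^N Φ_N` of the potential at `ħ = a`. -/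
def potentialAt (a : k) : CyclicWord k 3 := ∑ m ∈ Finset.Icc 1 N, a ^ m • Φ m

/-- The algebra `U_ħ(Φ_ħ)` over `k[ħ]`. -/
abbrev HbarAlgebra : Type _ := PotentialAlgebra k[X] (hbarPotential N Φ)

/-- The specialization `A ⊗_{k[ħ]} k[ħ] / (ħ - a)` of `A = U_ħ(Φ_ħ)`. -/
abbrev Specialization (a : k) : Type _ :=
  HbarAlgebra N Φ ⊗[k[X]] (k[X] ⧸ Ideal.span {(X - C a : k[X])})

/-- The generators of the specialization. -/
def specGen (a : k) (i : Fin 3) : Specialization N Φ a := gen k[X] (hbarPotential N Φ) i ⊗ₜ 1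

end Potential

end CyclicPotential

end

noncomputable section

namespace CyclicPotential

/-! ### Sorting words modulo deformed commutation relations -/

section Sorting

variable {R : Type*} [CommRing R] {n : ℕ}

/-! The core is a linear form of the diamond lemma. Insertion sort carries a word `w` to its sorted
form by adjacent transpositions. Paying for each transposition with a relator `ρ a b = [x_a, x_b] -
h q_ab` gives an element `sortPath ρ w` of the relation ideal `J` that is congruent to `w - sort w`
modulo `h`. By `sortPath_swap`, two words `u a b v` and `u b a v` have paths that differ by `u ρ_ab
v` modulo `hJ`, and not merely modulo `h`. The only obstruction is the hexagon of reorderings of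
three letters, and it closes by the Jacobi identity `∑ [r_i, x_i] = 0`. For a potential this
identity holds because `∑ (∂Φ/∂x_i) x_i` and `∑ x_i (∂Φ/∂x_i)` both list all rotations of each
cyclic word (`sum_relator_comm`).

Two properties of the linear extension `sorting` follow. By `sorting_add_orderedLift`, the operator
`sorting + orderedLift ∘ abelianize` is the identity modulo `h`. By `exists_sorting_eq`, each `j ∈
J` equals `sorting c` modulo `hJ`, with `c` congruent to `j` modulo `h` and killed by
abelianization.

Over `k[ħ]`, the second property lets one cancel `ħ`: if `ħ t ∈ J`, then `t ∈ J`, so `ħ` is regular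
on `A`. The first shows that the kernel of `A → S(V)` is `ħ A`. Hence multiplication by `ħ ^ l`
identifies `S(V)` with `Γ_l / Γ_{l+1}`.

Specialization at `ħ = a` is formal: evaluation of coefficients carries relators to relators.

For corrections of degree at most two, all of this respects word length, so it takes place in
finitely generated `k[ħ]`-modules. Nakayama's lemma then turns congruences modulo `ħ` into
equalities after multiplication by polynomials `r_m, p_m` with constant term one. Away from their
roots, which are countably many over all `m`, the specialized operator is bijective on words of
length at most `m`. This yields both spanning and independence of the ordered monomials, and
`isPBW_of_orderedMonomials` concludes. -/

/-- For a word `s` (thought of as sorted), the combination of the relators `ρ` by which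
`x_a * s` differs from the word obtained by moving the letter `a` to its place in `s`. -/
def insertPath (ρ : Fin n → Fin n → FreeAlgebra R (Fin n)) (a : Fin n) :
    List (Fin n) → FreeAlgebra R (Fin n)
  | [] => 0
  | b :: s => if a ≤ b then 0 else
      ρ a b * word R s + FreeAlgebra.ι R b * insertPath ρ a s

/-- The combination of the relators `ρ` by which a word differs from its sorted form. -/
def sortPath (ρ : Fin n → Fin n → FreeAlgebra R (Fin n)) :
    List (Fin n) → FreeAlgebra R (Fin n)
  | [] => 0
  | a :: w => FreeAlgebra.ι R a * sortPath ρ w + insertPath ρ a (w.insertionSort (· ≤ ·))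

theorem insertPath_of_le (ρ : Fin n → Fin n → FreeAlgebra R (Fin n)) {a : Fin n}
    {s : List (Fin n)} (hs : ∀ b ∈ s, a ≤ b) : insertPath ρ a s = 0 := by
  rcases s with _ | ⟨c, s⟩
  · rfl
  · simp [insertPath, hs c (by simp)]

@[simp] theorem word_nil : word R ([] : List (Fin n)) = 1 := rfl

@[simp] theorem word_cons (a : Fin n) (w : List (Fin n)) :
    word R (a :: w) = FreeAlgebra.ι R a * word R w := by simp [word]

theorem word_append (v w : List (Fin n)) : word R (v ++ w) = word R v * word R w := by
  simp [word]

/-- A family `ρ a b = [x_a, x_b] - h q_ab` of deformed commutation relations that satisfies the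
Jacobi identity, together with filtrations `W` of the free algebra and `J` of the ideal of
relations in which `q_ab` and `ρ a b` have degree two. -/
structure IsDeformation (h : R) (ρ q : Fin n → Fin n → FreeAlgebra R (Fin n))
    (W J : ℕ → Submodule R (FreeAlgebra R (Fin n))) : Prop where
  word_mem : ∀ w : List (Fin n), word R w ∈ W w.length
  mul_mem : ∀ {i j a b}, a ∈ W i → b ∈ J j → a * b ∈ J (i + j)
  mem_mul : ∀ {i j a b}, a ∈ J i → b ∈ W j → a * b ∈ J (i + j)
  ι_mul_mem : ∀ {i a} c, a ∈ W i → FreeAlgebra.ι R c * a ∈ W (i + 1)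
  mem_mul_word : ∀ {i a} w, a ∈ W i → a * word R w ∈ W (i + w.length)
  rel_mem : ∀ a b, ρ a b ∈ J 2
  q_mem : ∀ a b, q a b ∈ W 2
  rel_eq : ∀ a b, ρ a b = FreeAlgebra.ι R a * FreeAlgebra.ι R b
    - FreeAlgebra.ι R b * FreeAlgebra.ι R a - h • q a b
  antisymm : ∀ a b, ρ b a = -ρ a b
  jacobi : ∀ a b c, c < a → a < b →
    (ρ a b * FreeAlgebra.ι R c - FreeAlgebra.ι R c * ρ a b)
    + (ρ b c * FreeAlgebra.ι R a - FreeAlgebra.ι R a * ρ b c)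
    + (ρ c a * FreeAlgebra.ι R b - FreeAlgebra.ι R b * ρ c a) = 0

namespace IsDeformation

variable {h : R} {ρ q : Fin n → Fin n → FreeAlgebra R (Fin n)}
  {W J : ℕ → Submodule R (FreeAlgebra R (Fin n))} (D : IsDeformation h ρ q W J)

include D

theorem ι_mem (a : Fin n) : FreeAlgebra.ι R a ∈ W 1 := by
  simpa using D.word_mem [a]

theorem insertPath_mem (a : Fin n) (s : List (Fin n)) :
    insertPath ρ a s ∈ J (s.length + 1) := by
  induction s with
  | nil => exact zero_mem _
  | cons b s ih =>
    rw [insertPath]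
    split_ifs
    · exact zero_mem _
    · refine add_mem ?_ ?_
      · have := D.mem_mul (D.rel_mem a b) (D.word_mem s)
        rwa [show 2 + s.length = (b :: s).length + 1 by simp; omega] at this
      · have := D.mul_mem (D.ι_mem b) ih
        rwa [show 1 + (s.length + 1) = (b :: s).length + 1 by simp; omega] at this

theorem sortPath_mem (w : List (Fin n)) : sortPath ρ w ∈ J w.length := by
  induction w with
  | nil => exact zero_mem _
  | cons a w ih =>
    refine add_mem ?_ ?_
    · have := D.mul_mem (D.ι_mem a) ih
      rwa [add_comm] at this
    · simpa using D.insertPath_mem a (w.insertionSort (· ≤ ·))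

/-- Each transposition contributes a commutator minus `h q`. The commutators telescope, and the `h
q` terms are collected in `y`. -/
theorem insertPath_eq (a : Fin n) (s : List (Fin n)) : ∃ y ∈ W (s.length + 1),
    insertPath ρ a s = word R (a :: s) - word R (s.orderedInsert (· ≤ ·) a) + h • y := by
  induction s with
  | nil => exact ⟨0, zero_mem _, by simp [insertPath]⟩
  | cons b s ih =>
    rw [insertPath]
    split_ifs with hab
    · exact ⟨0, zero_mem _, by simp [hab]⟩
    · obtain ⟨y, hy, e⟩ := ih
      refine ⟨FreeAlgebra.ι R b * y - q a b * word R s, sub_mem (D.ι_mul_mem b hy) ?_, ?_⟩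
      · have := D.mem_mul_word s (D.q_mem a b)
        rwa [show 2 + s.length = (b :: s).length + 1 by simp; omega] at this
      · rw [e, D.rel_eq a b]
        simp only [List.orderedInsert, hab, if_false, word_cons, smul_sub, mul_add, mul_sub,
          sub_mul, mul_smul_comm, smul_mul_assoc, mul_assoc]
        abel

theorem sortPath_eq (w : List (Fin n)) : ∃ y ∈ W w.length,
    sortPath ρ w = word R w - word R (w.insertionSort (· ≤ ·)) + h • y := by
  induction w with
  | nil => exact ⟨0, zero_mem _, by simp [sortPath]⟩
  | cons a w ih =>
    obtain ⟨y, hy, e⟩ := ih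
    obtain ⟨z, hz, f⟩ := D.insertPath_eq a (w.insertionSort (· ≤ ·))
    rw [List.length_insertionSort] at hz
    refine ⟨FreeAlgebra.ι R a * y + z, add_mem (D.ι_mul_mem a hy) hz, ?_⟩
    rw [sortPath, e, f]
    simp only [word_cons, List.insertionSort_cons, smul_add, mul_add, mul_sub, mul_smul_comm]
    abel

/-- Local confluence: it compares the two orders of inserting `a` and `b` into a sorted word. If no
letter of `s` is below `a`, the orders differ by the single transposition of `a` and `b`. Otherwise
both letters pass the head `c`, and the resulting hexagon on `a`, `b`, `c` closes by the Jacobi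
identity. The point is that the error lies in `h J`, not just in multiples of `h`. -/
theorem insertPath_comm {a b : Fin n} (hab : a < b) (s : List (Fin n))
    (hs : s.Pairwise (· ≤ ·)) : ∃ y ∈ J (s.length + 2),
    FreeAlgebra.ι R a * insertPath ρ b s + insertPath ρ a (s.orderedInsert (· ≤ ·) b)
      - FreeAlgebra.ι R b * insertPath ρ a s - insertPath ρ b (s.orderedInsert (· ≤ ·) a)
      = ρ a b * word R s + h • y := by
  have base : ∀ s : List (Fin n), (∀ c ∈ s, a ≤ c) →
      FreeAlgebra.ι R a * insertPath ρ b s + insertPath ρ a (s.orderedInsert (· ≤ ·) b)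
      - FreeAlgebra.ι R b * insertPath ρ a s - insertPath ρ b (s.orderedInsert (· ≤ ·) a)
      = ρ a b * word R s := by
    intro s hc
    have h1 : s.orderedInsert (· ≤ ·) a = a :: s := by
      rcases s with _ | ⟨c, s⟩
      · rfl
      · simp [hc c (by simp)]
    rw [insertPath_of_le ρ hc,
      insertPath_of_le ρ (s := s.orderedInsert (· ≤ ·) b) (fun c hcs => ?_), h1, insertPath,
      if_neg (not_le.2 hab), D.antisymm a b]
    · simp
    · rcases (List.mem_orderedInsert _).1 hcs with rfl | hcs
      · exact hab.le
      · exact hc c hcs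
  induction s with
  | nil => exact ⟨0, zero_mem _, by rw [base _ (by simp)]; simp⟩
  | cons c s ih =>
    by_cases hc : a ≤ c
    · refine ⟨0, zero_mem _, ?_⟩
      rw [base]
      · simp
      · intro d hd
        rcases List.mem_cons.1 hd with rfl | hd
        · exact hc
        · exact hc.trans ((List.pairwise_cons.1 hs).1 d hd)
    · obtain ⟨y, hy, e⟩ := ih (List.pairwise_cons.1 hs).2
      obtain ⟨u, hu, f⟩ := D.insertPath_eq a s
      obtain ⟨v, hv, g⟩ := D.insertPath_eq b s
      have hbc : ¬ b ≤ c := fun hbc => hc (hab.le.trans hbc)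
      -- Moving `x_c` to the left past `x_a` in front of a path costs `ρ a c + h q a c`, whence the
      -- `q` terms. Merging the relator part with `ρ a c` times the inserted word gives `ρ a c *
      -- (x_b s + h v)`, whence the `v` term. The terms with opposite sign are those with `a` and
      -- `b` exchanged.
      refine ⟨FreeAlgebra.ι R c * y + q a c * insertPath ρ b s + ρ a c * v
        - q b c * insertPath ρ a s - ρ b c * u, ?_, ?_⟩
      · have e2 : (c :: s).length + 2 = 2 + (s.length + 1) := by simp; omega
        have e1 : (c :: s).length + 2 = 1 + (s.length + 2) := by simp; omega
        refine sub_mem (sub_mem (add_mem (add_mem ?_ ?_) ?_) ?_) ?_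
        · rw [e1]; exact D.mul_mem (D.ι_mem c) hy
        · rw [e2]; exact D.mul_mem (D.q_mem _ _) (D.insertPath_mem _ _)
        · rw [e2]; exact D.mem_mul (D.rel_mem _ _) hv
        · rw [e2]; exact D.mul_mem (D.q_mem _ _) (D.insertPath_mem _ _)
        · rw [e2]; exact D.mem_mul (D.rel_mem _ _) hu
      · have jac := D.jacobi a b c (not_le.1 hc) hab
        have ec := D.rel_eq a c
        have ed := D.rel_eq b c
        rw [D.antisymm a c] at jac
        simp only [List.orderedInsert, hc, hbc, if_false, insertPath, word_cons] at *
        generalize insertPath ρ a (s.orderedInsert (· ≤ ·) b) = A at *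
        generalize insertPath ρ b (s.orderedInsert (· ≤ ·) a) = B at *
        generalize word R (s.orderedInsert (· ≤ ·) b) = C at *
        generalize word R (s.orderedInsert (· ≤ ·) a) = E at *
        generalize ha : insertPath ρ a s = F at *
        generalize hb : insertPath ρ b s = G at *
        simp only [smul_add, smul_sub]
        rw [← mul_smul_comm h _ y, ← mul_smul_comm h _ u, ← mul_smul_comm h _ v,
          ← smul_mul_assoc, ← smul_mul_assoc]
        -- Solving for every multiple of `h` eliminates `h`. What remains is the Jacobi identity
        -- multiplied on the right by the word `s`.
        have q1 : h • q a c = FreeAlgebra.ι R a * FreeAlgebra.ι R c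
          - FreeAlgebra.ι R c * FreeAlgebra.ι R a - ρ a c := by rw [ec]; abel
        have q2 : h • q b c = FreeAlgebra.ι R b * FreeAlgebra.ι R c
          - FreeAlgebra.ι R c * FreeAlgebra.ι R b - ρ b c := by rw [ed]; abel
        have q3 : h • y = FreeAlgebra.ι R a * G + A - FreeAlgebra.ι R b * F - B
          - ρ a b * word R s := by rw [e]; abel
        have q4 : h • u = F - FreeAlgebra.ι R a * word R s + E := by rw [f]; abel
        have q5 : h • v = G - FreeAlgebra.ι R b * word R s + C := by rw [g]; abel
        rw [q1, q2, q3, q4, q5]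
        have jac' := congrArg (· * word R s) jac
        simp only [zero_mul] at jac'
        rw [← sub_eq_zero, ← neg_eq_zero, ← jac']
        noncomm_ring

/-- Besides the two insertions, the difference contains `[x_a, x_b]` times the path of `v`. Its
relator part joins `ρ a b * sort v` to produce `ρ a b * v`, up to `h ρ a b z`. -/
theorem sortPath_swap_of_lt {a b : Fin n} (hab : a < b) (v : List (Fin n)) :
    ∃ y ∈ J (v.length + 2),
    sortPath ρ (a :: b :: v) - sortPath ρ (b :: a :: v) = ρ a b * word R v + h • y := by
  obtain ⟨y, hy, e⟩ := D.insertPath_comm hab (v.insertionSort (· ≤ ·))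
    (List.pairwise_insertionSort _ _)
  obtain ⟨z, hz, f⟩ := D.sortPath_eq v
  rw [List.length_insertionSort] at hy
  refine ⟨y + q a b * sortPath ρ v + ρ a b * z, add_mem (add_mem hy ?_) ?_, ?_⟩
  · rw [add_comm v.length]; exact D.mul_mem (D.q_mem _ _) (D.sortPath_mem _)
  · rw [add_comm v.length]; exact D.mem_mul (D.rel_mem _ _) hz
  · have ed := D.rel_eq a b
    simp only [sortPath, List.insertionSort_cons]
    rw [smul_add, smul_add, ← mul_smul_comm h _ z, ← smul_mul_assoc]
    have q1 : h • q a b = FreeAlgebra.ι R a * FreeAlgebra.ι R b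
          - FreeAlgebra.ι R b * FreeAlgebra.ι R a - ρ a b := by rw [ed]; abel
    have q2 : h • z = sortPath ρ v - word R v + word R (v.insertionSort (· ≤ ·)) := by
      rw [f]; abel
    rw [q1, q2, eq_sub_of_add_eq' e.symm]
    noncomm_ring

/-- A prefix letter is inserted into the same sorted word on both sides, so its insertion path
cancels. The hypothesis `hself` is separate because antisymmetry only gives `2 ρ a a = 0`. -/
theorem sortPath_swap (hself : ∀ a, ρ a a = 0) (a b : Fin n) (u v : List (Fin n)) :
    ∃ y ∈ J (u.length + v.length + 2),
    sortPath ρ (u ++ a :: b :: v) - sortPath ρ (u ++ b :: a :: v)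
      = word R u * ρ a b * word R v + h • y := by
  induction u with
  | nil =>
    rw [List.length_nil, zero_add]
    rcases lt_trichotomy a b with hab | rfl | hab
    · simpa using D.sortPath_swap_of_lt hab v
    · exact ⟨0, zero_mem _, by simp [hself]⟩
    · obtain ⟨y, hy, e⟩ := D.sortPath_swap_of_lt hab v
      refine ⟨-y, neg_mem hy, ?_⟩
      rw [D.antisymm b a, List.nil_append, List.nil_append, ← neg_sub, e]
      simp; abel
  | cons c u ih =>
    obtain ⟨y, hy, e⟩ := ih
    refine ⟨FreeAlgebra.ι R c * y, ?_, ?_⟩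
    · have := D.mul_mem (D.ι_mem c) hy
      rwa [show 1 + (u.length + v.length + 2) = (c :: u).length + v.length + 2 by
        simp; omega] at this
    · have hp : (u ++ a :: b :: v).insertionSort (· ≤ ·)
          = (u ++ b :: a :: v).insertionSort (· ≤ ·) := by
        refine List.Perm.eq_of_pairwise' (List.pairwise_insertionSort _ _)
          (List.pairwise_insertionSort _ _) ?_
        exact ((List.perm_insertionSort _ _).trans
          ((List.Perm.swap b a v).append_left u)).trans (List.perm_insertionSort _ _).symm
      simp only [List.cons_append, sortPath, hp, word_cons]
      rw [add_sub_add_right_eq_sub, ← mul_sub, e, mul_add, mul_smul_comm]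
      simp only [mul_assoc]

end IsDeformation

end Sorting

/-! ### Ordered monomials, abelianization and the linear sorting operator -/

section SortedWords

variable {R : Type*} [CommRing R] {n : ℕ}

theorem span_range_word : Submodule.span R (Set.range (word R (n := n))) = ⊤ := by
  rw [← (FreeAlgebra.basisFreeMonoid R (Fin n)).span_eq]
  congr 1
  ext t
  constructor
  · rintro ⟨w, rfl⟩
    exact ⟨FreeMonoid.ofList w, basis_eq_word R _⟩
  · rintro ⟨w, rfl⟩
    exact ⟨w.toList, (basis_eq_word R _).symm⟩

theorem wordSpan_ι (d : ℕ) : wordSpan R (FreeAlgebra.ι R) d =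
    Submodule.span R (word R '' {w : List (Fin n) | w.length ≤ d}) := rfl

/-- The increasing word in which each letter `i` occurs `α i` times. -/
def sortedWord (α : Fin n →₀ ℕ) : List (Fin n) :=
  (List.finRange n).flatMap fun i => List.replicate (α i) i

theorem count_sortedWord (α : Fin n →₀ ℕ) (i : Fin n) : (sortedWord α).count i = α i := by
  rw [sortedWord, List.count_flatMap]
  have : (List.count i ∘ fun j => List.replicate (α j) j) = fun j => if j = i then α i else 0 := by
    ext j
    simp only [Function.comp, List.count_replicate, beq_iff_eq]
    split_ifs with h <;> simp [h]
  rw [this, ← Fin.sum_univ_def]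
  simp

theorem pairwise_sortedWord (α : Fin n →₀ ℕ) : (sortedWord α).Pairwise (· ≤ ·) := by
  rw [sortedWord, List.pairwise_flatMap]
  refine ⟨fun i _ => List.pairwise_replicate.2 (Or.inr le_rfl), ?_⟩
  refine (List.pairwise_lt_finRange n).imp fun {a b} hab i hi j hj => ?_
  rw [List.eq_of_mem_replicate hi, List.eq_of_mem_replicate hj]
  exact hab.le

theorem orderedMonomial_eq {A : Type*} [Ring A] (x : Fin n → A) (α : Fin n →₀ ℕ) :
    orderedMonomial x α = ((sortedWord α).map x).prod := by
  rw [orderedMonomial, sortedWord, List.map_flatMap]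
  generalize List.finRange n = l
  induction l with
  | nil => simp
  | cons i l ih => simp [List.flatMap_cons, ih]

theorem length_sortedWord (α : Fin n →₀ ℕ) : (sortedWord α).length = α.degree := by
  rw [sortedWord, List.length_flatMap, Finsupp.degree_eq_sum]
  simp [Fin.sum_univ_def]

/-- The exponent of the commutative monomial given by a word. -/
def content (w : List (Fin n)) : Fin n →₀ ℕ := Multiset.toFinsupp (w : Multiset (Fin n))

theorem content_apply (w : List (Fin n)) (i : Fin n) : content w i = w.count i := by
  simp [content]

theorem content_sortedWord (α : Fin n →₀ ℕ) : content (sortedWord α) = α := by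
  ext i
  rw [content_apply, count_sortedWord]

theorem sortedWord_content (w : List (Fin n)) :
    sortedWord (content w) = w.insertionSort (· ≤ ·) := by
  refine List.Perm.eq_of_pairwise' (pairwise_sortedWord _) (List.pairwise_insertionSort _ _) ?_
  refine List.Perm.trans (List.perm_iff_count.2 fun i => ?_) (List.perm_insertionSort _ _).symm
  rw [count_sortedWord, content_apply]

theorem degree_content (w : List (Fin n)) : (content w).degree = w.length := by
  rw [← length_sortedWord, sortedWord_content, List.length_insertionSort]

theorem sortPath_of_pairwise (ρ : Fin n → Fin n → FreeAlgebra R (Fin n)) {w : List (Fin n)}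
    (hw : w.Pairwise (· ≤ ·)) : sortPath ρ w = 0 := by
  induction w with
  | nil => rfl
  | cons a w ih =>
    obtain ⟨h1, h2⟩ := List.pairwise_cons.1 hw
    rw [sortPath, ih h2, h2.insertionSort_eq, insertPath_of_le ρ h1]
    simp

variable (R n) in
/-- The canonical homomorphism to the polynomial algebra. -/
def abelianize : FreeAlgebra R (Fin n) →ₐ[R] MvPolynomial (Fin n) R :=
  FreeAlgebra.lift R MvPolynomial.X

theorem abelianize_word (w : List (Fin n)) :
    abelianize R n (word R w) = MvPolynomial.monomial (content w) 1 := by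
  induction w with
  | nil => simp [content]
  | cons a w ih =>
    rw [word_cons, map_mul, ih, abelianize, FreeAlgebra.lift_ι_apply, MvPolynomial.X,
      MvPolynomial.monomial_mul, one_mul]
    congr 1
    rw [content, content, ← Multiset.cons_coe, ← Multiset.singleton_add, map_add,
      Multiset.toFinsupp_singleton]

/-- The linear map that sends each commutative monomial to the ordered monomial in the elements
`x i`. -/
def orderedLift {A : Type*} [Ring A] [Algebra R A] (x : Fin n → A) :
    MvPolynomial (Fin n) R →ₗ[R] A :=
  (MvPolynomial.basisMonomials (Fin n) R).constr R (orderedMonomial x)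

theorem orderedLift_monomial {A : Type*} [Ring A] [Algebra R A] (x : Fin n → A)
    (α : Fin n →₀ ℕ) : orderedLift x (MvPolynomial.monomial α (1 : R)) = orderedMonomial x α := by
  have := (MvPolynomial.basisMonomials (Fin n) R).constr_basis R (orderedMonomial x) α
  rwa [MvPolynomial.coe_basisMonomials] at this

theorem orderedMonomial_ι (α : Fin n →₀ ℕ) :
    orderedMonomial (FreeAlgebra.ι R) α = word R (sortedWord α) :=
  orderedMonomial_eq _ _

theorem orderedLift_abelianize_word (w : List (Fin n)) :
    orderedLift (FreeAlgebra.ι R) (abelianize R n (word R w)) =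
      word R (w.insertionSort (· ≤ ·)) := by
  rw [abelianize_word, orderedLift_monomial, orderedMonomial_ι, sortedWord_content]

theorem abelianize_orderedLift (f : MvPolynomial (Fin n) R) :
    abelianize R n (orderedLift (FreeAlgebra.ι R) f) = f := by
  have : (abelianize R n).toLinearMap ∘ₗ orderedLift (FreeAlgebra.ι R) = LinearMap.id := by
    refine (MvPolynomial.basisMonomials (Fin n) R).ext fun α => ?_
    simp [orderedLift_monomial, orderedMonomial_ι, abelianize_word, content_sortedWord]
  exact LinearMap.congr_fun this f

variable (ρ : Fin n → Fin n → FreeAlgebra R (Fin n))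

/-- The linear extension of `sortPath`. -/
def sorting : FreeAlgebra R (Fin n) →ₗ[R] FreeAlgebra R (Fin n) :=
  (FreeAlgebra.basisFreeMonoid R (Fin n)).constr R fun w => sortPath ρ w.toList

theorem sorting_word (w : List (Fin n)) : sorting ρ (word R w) = sortPath ρ w := by
  have h := (FreeAlgebra.basisFreeMonoid R (Fin n)).constr_basis R
    (fun w => sortPath ρ w.toList) (FreeMonoid.ofList w)
  rwa [basis_eq_word] at h

theorem sorting_orderedLift (f : MvPolynomial (Fin n) R) :
    sorting ρ (orderedLift (FreeAlgebra.ι R) f) = 0 := by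
  have : sorting ρ ∘ₗ orderedLift (FreeAlgebra.ι R) = 0 := by
    refine (MvPolynomial.basisMonomials (Fin n) R).ext fun α => ?_
    simp [orderedLift_monomial, orderedMonomial_ι, sorting_word,
      sortPath_of_pairwise ρ (pairwise_sortedWord α)]
  exact LinearMap.congr_fun this f

/-- The span of the elements `u * ρ a b * v`, where `(u, v)` runs through a set of pairs of
words. -/
def relSpan (S : Set (List (Fin n) × List (Fin n))) : Submodule R (FreeAlgebra R (Fin n)) :=
  Submodule.span R {t | ∃ u v a b, (u, v) ∈ S ∧ word R u * ρ a b * word R v = t}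

/-- The pairs of words of total length at most `m - 2`. -/
def shortPairs (n m : ℕ) : Set (List (Fin n) × List (Fin n)) :=
  {p | p.1.length + p.2.length + 2 ≤ m}

theorem span_word_mul_relSpan {s : Set (List (Fin n))} {S S' : Set (List (Fin n) × List (Fin n))}
    (h : ∀ w ∈ s, ∀ u v, (u, v) ∈ S → (w ++ u, v) ∈ S') {a b : FreeAlgebra R (Fin n)}
    (ha : a ∈ Submodule.span R (word R '' s)) (hb : b ∈ relSpan ρ S) : a * b ∈ relSpan ρ S' := by
  have := Submodule.mul_mem_mul ha hb
  rw [relSpan, Submodule.span_mul_span] at this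
  refine Submodule.span_mono ?_ this
  rintro _ ⟨_, ⟨w, hw, rfl⟩, _, ⟨u, v, c, d, huv, rfl⟩, rfl⟩
  exact ⟨w ++ u, v, c, d, h w hw u v huv, by simp only [word_append, mul_assoc]⟩

theorem relSpan_mul_span_word {s : Set (List (Fin n))} {S S' : Set (List (Fin n) × List (Fin n))}
    (h : ∀ w ∈ s, ∀ u v, (u, v) ∈ S → (u, v ++ w) ∈ S') {a b : FreeAlgebra R (Fin n)}
    (ha : a ∈ relSpan ρ S) (hb : b ∈ Submodule.span R (word R '' s)) : a * b ∈ relSpan ρ S' := by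
  have := Submodule.mul_mem_mul ha hb
  rw [relSpan, Submodule.span_mul_span] at this
  refine Submodule.span_mono ?_ this
  rintro _ ⟨_, ⟨u, v, c, d, huv, rfl⟩, _, ⟨w, hw, rfl⟩, rfl⟩
  exact ⟨u, v ++ w, c, d, h w hw u v huv, by simp only [word_append, mul_assoc]⟩

theorem rel_mem_relSpan {S : Set (List (Fin n) × List (Fin n))} (h : ([], []) ∈ S)
    (a b : Fin n) : ρ a b ∈ relSpan ρ S :=
  Submodule.subset_span ⟨[], [], a, b, h, by simp⟩

theorem mul_mem_relSpan_univ (a : FreeAlgebra R (Fin n)) {b : FreeAlgebra R (Fin n)}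
    (hb : b ∈ relSpan ρ Set.univ) : a * b ∈ relSpan ρ Set.univ :=
  span_word_mul_relSpan ρ (s := Set.univ) (fun _ _ _ _ _ => Set.mem_univ _)
    (by rw [Set.image_univ, span_range_word]; trivial) hb

theorem relSpan_univ_mul_mem {a : FreeAlgebra R (Fin n)} (b : FreeAlgebra R (Fin n))
    (ha : a ∈ relSpan ρ Set.univ) : a * b ∈ relSpan ρ Set.univ :=
  relSpan_mul_span_word ρ (s := Set.univ) (fun _ _ _ _ _ => Set.mem_univ _) ha
    (by rw [Set.image_univ, span_range_word]; trivial)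

namespace IsDeformation

variable {ρ} {h : R} {q : Fin n → Fin n → FreeAlgebra R (Fin n)}
  {W J : ℕ → Submodule R (FreeAlgebra R (Fin n))}

/-- The version without length control, for corrections of arbitrary degree: both filtrations are
constant. -/
theorem of_relations (hr : ∀ a b, ρ a b = FreeAlgebra.ι R a * FreeAlgebra.ι R b
      - FreeAlgebra.ι R b * FreeAlgebra.ι R a - h • q a b)
    (ha : ∀ a b, ρ b a = -ρ a b)
    (hj : ∀ a b c, c < a → a < b →
      (ρ a b * FreeAlgebra.ι R c - FreeAlgebra.ι R c * ρ a b)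
      + (ρ b c * FreeAlgebra.ι R a - FreeAlgebra.ι R a * ρ b c)
      + (ρ c a * FreeAlgebra.ι R b - FreeAlgebra.ι R b * ρ c a) = 0) :
    IsDeformation h ρ q (fun _ => ⊤) (fun _ => relSpan ρ Set.univ) where
  word_mem _ := trivial
  mul_mem _ hb := mul_mem_relSpan_univ ρ _ hb
  mem_mul ha _ := relSpan_univ_mul_mem ρ _ ha
  ι_mul_mem _ _ := trivial
  mem_mul_word _ _ := trivial
  rel_mem a b := rel_mem_relSpan ρ (Set.mem_univ _) a b
  q_mem _ _ := trivial
  rel_eq := hr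
  antisymm := ha
  jacobi := hj

/-- Corrections of degree at most two do not lengthen words, so sorting is compatible with the
filtrations by length. -/
theorem of_quadratic (hr : ∀ a b, ρ a b = FreeAlgebra.ι R a * FreeAlgebra.ι R b
      - FreeAlgebra.ι R b * FreeAlgebra.ι R a - h • q a b)
    (hq : ∀ a b, q a b ∈ wordSpan R (FreeAlgebra.ι R) 2)
    (ha : ∀ a b, ρ b a = -ρ a b)
    (hj : ∀ a b c, c < a → a < b →
      (ρ a b * FreeAlgebra.ι R c - FreeAlgebra.ι R c * ρ a b)
      + (ρ b c * FreeAlgebra.ι R a - FreeAlgebra.ι R a * ρ b c)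
      + (ρ c a * FreeAlgebra.ι R b - FreeAlgebra.ι R b * ρ c a) = 0) :
    IsDeformation h ρ q (wordSpan R (FreeAlgebra.ι R)) (fun m => relSpan ρ (shortPairs n m)) where
  word_mem w := Submodule.subset_span ⟨w, le_rfl, rfl⟩
  mul_mem {i j _ _} ha hb := span_word_mul_relSpan ρ (s := {w | w.length ≤ i})
    (fun w hw u v huv => by
      have h1 : w.length ≤ i := hw
      have h2 : u.length + v.length + 2 ≤ j := huv
      change (w ++ u).length + v.length + 2 ≤ i + j
      rw [List.length_append]; omega) ha hb
  mem_mul {i j _ _} ha hb := relSpan_mul_span_word ρ (s := {w | w.length ≤ j})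
    (fun w hw u v huv => by
      have h1 : w.length ≤ j := hw
      have h2 : u.length + v.length + 2 ≤ i := huv
      change u.length + (v ++ w).length + 2 ≤ i + j
      rw [List.length_append]; omega) ha hb
  ι_mul_mem {i a} c ha := by
    rw [add_comm]
    exact mul_mem_wordSpan R _ (Submodule.subset_span ⟨[c], by simp, by simp⟩) ha
  mem_mul_word w ha := mul_mem_wordSpan R _ ha (Submodule.subset_span ⟨w, le_rfl, rfl⟩)
  rel_mem a b := rel_mem_relSpan ρ (by simp [shortPairs]) a b
  q_mem := hq
  rel_eq := hr
  antisymm := ha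
  jacobi := hj

variable (D : IsDeformation h ρ q W J)

include D

theorem sorting_mem {s : Set (List (Fin n))} {U : Submodule R (FreeAlgebra R (Fin n))}
    (hU : ∀ w ∈ s, J w.length ≤ U) {t : FreeAlgebra R (Fin n)}
    (ht : t ∈ Submodule.span R (word R '' s)) : sorting ρ t ∈ U := by
  induction ht using Submodule.span_induction with
  | mem t ht =>
    obtain ⟨w, hw, rfl⟩ := ht
    rw [sorting_word]
    exact hU w hw (D.sortPath_mem w)
  | zero => simp
  | add t u _ _ ht hu => rw [map_add]; exact add_mem ht hu
  | smul r t _ ht => rw [map_smul]; exact Submodule.smul_mem _ r ht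

/-- On a word the second summand is the sorted word, so this is `sortPath_eq` extended linearly: the
operator is the identity modulo `h`, with the error controlled by `V`. -/
theorem sorting_add_orderedLift {s : Set (List (Fin n))}
    {V : Submodule R (FreeAlgebra R (Fin n))} (hV : ∀ w ∈ s, W w.length ≤ V)
    {t : FreeAlgebra R (Fin n)} (ht : t ∈ Submodule.span R (word R '' s)) :
    ∃ y ∈ V, sorting ρ t + orderedLift (FreeAlgebra.ι R) (abelianize R n t) = t + h • y := by
  induction ht using Submodule.span_induction with
  | mem t ht =>
    obtain ⟨w, hw, rfl⟩ := ht
    obtain ⟨y, hy, e⟩ := D.sortPath_eq w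
    refine ⟨y, hV w hw hy, ?_⟩
    rw [sorting_word, orderedLift_abelianize_word, e]
    abel
  | zero => exact ⟨0, zero_mem _, by simp⟩
  | add t u _ _ ht hu =>
    obtain ⟨y, hy, e⟩ := ht
    obtain ⟨z, hz, f⟩ := hu
    refine ⟨y + z, add_mem hy hz, ?_⟩
    rw [map_add, map_add, map_add, add_add_add_comm, e, f, smul_add]
    abel
  | smul r t _ ht =>
    obtain ⟨y, hy, e⟩ := ht
    refine ⟨r • y, Submodule.smul_mem _ _ hy, ?_⟩
    rw [map_smul, map_smul, map_smul, ← smul_add, e, smul_add, smul_comm]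

/-- For a generator `u ρ_ab v` take `c = u a b v - u b a v`. It dies under abelianization, it
differs from the generator by `h u q_ab v`, and `sortPath_swap` computes its image under `sorting`.
-/
theorem exists_sorting_eq {S : Set (List (Fin n) × List (Fin n))}
    {U V : Submodule R (FreeAlgebra R (Fin n))} (hself : ∀ a, ρ a a = 0)
    (hU : ∀ u v, (u, v) ∈ S → J (u.length + v.length + 2) ≤ U)
    (hV : ∀ u v, (u, v) ∈ S → W (u.length + 2 + v.length) ≤ V)
    (hq : ∀ (u : List (Fin n)) a b, word R u * q a b ∈ W (u.length + 2))
    {j : FreeAlgebra R (Fin n)} (hj : j ∈ relSpan ρ S) :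
    ∃ c, abelianize R n c = 0 ∧ (∃ y ∈ U, sorting ρ c = j + h • y) ∧
      ∃ z ∈ V, c = j + h • z := by
  induction hj using Submodule.span_induction with
  | mem t ht =>
    obtain ⟨u, v, a, b, huv, rfl⟩ := ht
    obtain ⟨y, hy, e⟩ := D.sortPath_swap hself a b u v
    refine ⟨word R (u ++ a :: b :: v) - word R (u ++ b :: a :: v), ?_, ⟨y, hU u v huv hy, ?_⟩,
      word R u * q a b * word R v, hV u v huv (D.mem_mul_word v (hq u a b)), ?_⟩
    · simp only [word_append, word_cons, map_sub, map_mul]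
      ring
    · rw [map_sub, sorting_word, sorting_word, e]
    · rw [D.rel_eq a b]
      simp only [word_append, word_cons, mul_sub, sub_mul, mul_smul_comm, smul_mul_assoc, mul_assoc]
      abel
  | zero => exact ⟨0, by simp, ⟨0, zero_mem _, by simp⟩, 0, zero_mem _, by simp⟩
  | add t u _ _ ht hu =>
    obtain ⟨c, hc, ⟨y, hy, e⟩, z, hz, f⟩ := ht
    obtain ⟨c', hc', ⟨y', hy', e'⟩, z', hz', f'⟩ := hu
    refine ⟨c + c', by simp [hc, hc'], ⟨y + y', add_mem hy hy', ?_⟩, z + z', add_mem hz hz', ?_⟩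
    · rw [map_add, e, e', smul_add]; abel
    · rw [f, f', smul_add]; abel
  | smul r t _ ht =>
    obtain ⟨c, hc, ⟨y, hy, e⟩, z, hz, f⟩ := ht
    refine ⟨r • c, by simp [hc], ⟨r • y, Submodule.smul_mem _ _ hy, ?_⟩, r • z,
      Submodule.smul_mem _ _ hz, ?_⟩
    · rw [map_smul, e, smul_add, smul_comm]
    · rw [f, smul_add, smul_comm]

end IsDeformation

end SortedWords

/-! ### The Jacobi identity for cyclic potentials and the ideal of relations -/

section Relators

variable {R : Type*} [CommRing R]

theorem sum_cutAt_mul_ι {n : ℕ} (w : List (Fin n)) {j : ℕ} (hj : j < w.length) :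
    ∑ i, cutAt R i w j * FreeAlgebra.ι R i = word R (w.drop (j + 1) ++ w.take (j + 1)) := by
  simp only [cutAt, List.getElem?_eq_getElem hj, Option.some.injEq, ite_mul, zero_mul,
    Finset.sum_ite_eq, Finset.mem_univ, if_true]
  rw [← List.take_append_getElem hj, ← List.append_assoc, word_append _ [_]]
  simp

theorem sum_ι_mul_cutAt {n : ℕ} (w : List (Fin n)) {j : ℕ} (hj : j < w.length) :
    ∑ i, FreeAlgebra.ι R i * cutAt R i w j = word R (w.drop j ++ w.take j) := by
  simp only [cutAt, List.getElem?_eq_getElem hj, Option.some.injEq, mul_ite, mul_zero,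
    Finset.sum_ite_eq, Finset.mem_univ, if_true]
  rw [← word_cons, ← List.cons_append, List.getElem_cons_drop]

/-- For a word, putting the removed letter back at either end gives a rotation, and both sums run
over all rotations. -/
theorem sum_wordDeriv_mul_ι {n : ℕ} (t : FreeAlgebra R (Fin n)) :
    ∑ i, wordDeriv R i t * FreeAlgebra.ι R i = ∑ i, FreeAlgebra.ι R i * wordDeriv R i t := by
  have ht : t ∈ Submodule.span R (Set.range (word R (n := n))) := by
    rw [span_range_word]; trivial
  induction ht using Submodule.span_induction with
  | mem t ht =>
    obtain ⟨w, rfl⟩ := ht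
    simp only [wordDeriv_word, Finset.sum_mul, Finset.mul_sum]
    rw [Finset.sum_comm, Finset.sum_comm (s := Finset.univ),
      Finset.sum_congr rfl fun j hj => sum_cutAt_mul_ι (R := R) w (Finset.mem_range.1 hj),
      Finset.sum_congr rfl fun j hj => sum_ι_mul_cutAt (R := R) w (Finset.mem_range.1 hj)]
    -- The two sums are over cuts `1, …, length` and `0, …, length - 1`. The extreme cuts `0` and
    -- `length` give the same word.
    have h1 := Finset.sum_range_succ (fun j => word R (w.drop j ++ w.take j)) w.length
    rw [Finset.sum_range_succ'] at h1
    simpa using h1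
  | zero => simp
  | add t u _ _ ht hu => simp only [map_add, add_mul, mul_add, Finset.sum_add_distrib, ht, hu]
  | smul r t _ ht =>
    simp only [map_smul, smul_mul_assoc, mul_smul_comm, ← Finset.smul_sum, ht]

/-- The commutator parts cancel by the Jacobi identity of the free algebra, the derivative parts by
`sum_wordDeriv_mul_ι`. -/
theorem sum_relator_comm (Φ : CyclicWord R 3) :
    ∑ i, (relator R Φ i * FreeAlgebra.ι R i - FreeAlgebra.ι R i * relator R Φ i) = 0 := by
  obtain ⟨t, rfl⟩ := Submodule.Quotient.mk_surjective _ Φ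
  have h := sum_wordDeriv_mul_ι t
  have hd : ∀ i, cyclicDeriv R i (Submodule.Quotient.mk t) = wordDeriv R i t := fun _ => rfl
  rw [← sub_eq_zero, ← neg_eq_zero] at h
  rw [← h]
  simp only [Fin.sum_univ_three, relator, hd]
  simp only [Fin.isValue, zero_add, show (1 : Fin 3) + 1 = 2 from rfl,
    show (1 : Fin 3) + 2 = 0 from rfl, show (2 : Fin 3) + 1 = 0 from rfl,
    show (2 : Fin 3) + 2 = 1 from rfl]
  noncomm_ring

theorem koszulD_koszulXi (Φ : CyclicWord R 3) : koszulD R Φ (koszulXi R) = 0 := by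
  rw [← sum_relator_comm Φ]
  simp [koszulD, koszulXi]

/-- The antisymmetric array of relators `ρ (i + 1) (i + 2) = r i`. -/
def crossArray (r : Fin 3 → FreeAlgebra R (Fin 3)) (a b : Fin 3) : FreeAlgebra R (Fin 3) :=
  if b = a + 1 then r (a + 2) else if a = b + 1 then -r (b + 2) else 0

theorem crossArray_self (r : Fin 3 → FreeAlgebra R (Fin 3)) (a : Fin 3) :
    crossArray r a a = 0 := by
  fin_cases a <;> simp [crossArray]

theorem crossArray_antisymm (r : Fin 3 → FreeAlgebra R (Fin 3)) (a b : Fin 3) :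
    crossArray r b a = -crossArray r a b := by
  fin_cases a <;> fin_cases b <;> simp [crossArray]

theorem crossArray_succ (r : Fin 3 → FreeAlgebra R (Fin 3)) (i : Fin 3) :
    crossArray r (i + 1) (i + 2) = r i := by
  fin_cases i <;> simp [crossArray]

theorem crossArray_mem (r : Fin 3 → FreeAlgebra R (Fin 3))
    {V : Submodule R (FreeAlgebra R (Fin 3))} (hr : ∀ i, r i ∈ V) (a b : Fin 3) :
    crossArray r a b ∈ V := by
  rw [crossArray]
  split_ifs
  exacts [hr _, neg_mem (hr _), zero_mem _]

theorem crossArray_eq {r q : Fin 3 → FreeAlgebra R (Fin 3)} {h : R}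
    (hr : ∀ i, r i = FreeAlgebra.ι R (i + 1) * FreeAlgebra.ι R (i + 2)
      - FreeAlgebra.ι R (i + 2) * FreeAlgebra.ι R (i + 1) - h • q i) (a b : Fin 3) :
    crossArray r a b = FreeAlgebra.ι R a * FreeAlgebra.ι R b
      - FreeAlgebra.ι R b * FreeAlgebra.ι R a - h • crossArray q a b := by
  have h0 := hr 0
  have h1 := hr 1
  have h2 := hr 2
  simp only [Fin.isValue, zero_add, show (1 : Fin 3) + 1 = 2 from rfl,
    show (1 : Fin 3) + 2 = 0 from rfl, show (2 : Fin 3) + 1 = 0 from rfl,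
    show (2 : Fin 3) + 2 = 1 from rfl] at h0 h1 h2
  fin_cases a <;> fin_cases b <;> simp [crossArray, h0, h1, h2] <;> abel

theorem crossArray_jacobi {r : Fin 3 → FreeAlgebra R (Fin 3)}
    (hr : ∑ i, (r i * FreeAlgebra.ι R i - FreeAlgebra.ι R i * r i) = 0) (a b c : Fin 3)
    (hca : c < a) (hab : a < b) :
    (crossArray r a b * FreeAlgebra.ι R c - FreeAlgebra.ι R c * crossArray r a b)
      + (crossArray r b c * FreeAlgebra.ι R a - FreeAlgebra.ι R a * crossArray r b c)
      + (crossArray r c a * FreeAlgebra.ι R b - FreeAlgebra.ι R b * crossArray r c a) = 0 := by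
  obtain rfl : c = 0 := by omega
  obtain rfl : a = 1 := by omega
  obtain rfl : b = 2 := by omega
  rw [Fin.sum_univ_three] at hr
  simpa [crossArray] using hr

/-- The deformed commutation relations of `U(Φ)`. -/
def relatorArray (Φ : CyclicWord R 3) : Fin 3 → Fin 3 → FreeAlgebra R (Fin 3) :=
  crossArray (relator R Φ)

variable (Φ : CyclicWord R 3)

/-- The canonical projection of the free algebra onto `U(Φ)`. -/
def toPotential : FreeAlgebra R (Fin 3) →ₐ[R] PotentialAlgebra R Φ := RingQuot.mkAlgHom R _

theorem toPotential_ι (i : Fin 3) : toPotential Φ (FreeAlgebra.ι R i) = gen R Φ i := rfl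

theorem toPotential_surjective : Function.Surjective (toPotential Φ) :=
  RingQuot.mkAlgHom_surjective R _

theorem toPotential_relator (i : Fin 3) : toPotential Φ (relator R Φ i) = 0 := by
  rw [← map_zero (toPotential Φ)]
  exact RingQuot.mkAlgHom_rel R ⟨⟨i, rfl⟩, rfl⟩

theorem relator_mem_relSpan (i : Fin 3) :
    relator R Φ i ∈ relSpan (relatorArray Φ) Set.univ := by
  rw [← crossArray_succ (relator R Φ) i]
  exact rel_mem_relSpan _ (Set.mem_univ _) _ _

/-- The ideal of relations of `U(Φ)`. -/
def relIdeal : Ideal (FreeAlgebra R (Fin 3)) where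
  carrier := relSpan (relatorArray Φ) Set.univ
  add_mem' := add_mem
  zero_mem' := zero_mem _
  smul_mem' a _ hb := mul_mem_relSpan_univ _ a hb

instance : (relIdeal Φ).IsTwoSided := ⟨fun b ha => relSpan_univ_mul_mem _ b ha⟩

/-- This links the abstract ring quotient to the span on which `sorting` is controlled. That span is
a two-sided ideal containing the relators, so the projection to its quotient ring factors through
`U(Φ)`. -/
theorem toPotential_eq_zero_iff (t : FreeAlgebra R (Fin 3)) :
    toPotential Φ t = 0 ↔ t ∈ relSpan (relatorArray Φ) Set.univ := by
  constructor
  · intro ht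
    let f : PotentialAlgebra R Φ →ₐ[R] FreeAlgebra R (Fin 3) ⧸ relIdeal Φ :=
      RingQuot.liftAlgHom R ⟨Ideal.Quotient.mkₐ R (relIdeal Φ), by
        rintro _ _ ⟨⟨i, rfl⟩, rfl⟩
        rw [map_zero]
        exact Ideal.Quotient.eq_zero_iff_mem.2 (relator_mem_relSpan Φ i)⟩
    have h : f (toPotential Φ t) = Ideal.Quotient.mk (relIdeal Φ) t :=
      RingQuot.liftAlgHom_mkAlgHom_apply R _ _ t
    rw [ht, map_zero] at h
    exact Ideal.Quotient.eq_zero_iff_mem.1 h.symm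
  · intro ht
    induction ht using Submodule.span_induction with
    | mem t ht =>
      obtain ⟨u, v, a, b, -, rfl⟩ := ht
      have : relatorArray Φ a b ∈ LinearMap.ker (toPotential Φ).toLinearMap :=
        crossArray_mem _ (fun i => toPotential_relator Φ i) a b
      have h : toPotential Φ (relatorArray Φ a b) = 0 := this
      rw [map_mul, map_mul, h, mul_zero, zero_mul]
    | zero => simp
    | add t u _ _ ht hu => rw [map_add, ht, hu, add_zero]
    | smul r t _ ht => rw [map_smul, ht, smul_zero]

theorem toPotential_word (w : List (Fin 3)) :
    toPotential Φ (word R w) = (w.map (gen R Φ)).prod := by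
  rw [word, map_list_prod, List.map_map]
  rfl

end Relators

/-! ### Change of coefficients -/

section BaseChange

variable {R S : Type*} [CommRing R] [CommRing S] {n : ℕ} (φ : R →+* S)

/-- The change of coefficients along a ring homomorphism. -/
def mapCoeff (n : ℕ) : FreeAlgebra R (Fin n) →+* FreeAlgebra S (Fin n) :=
  letI := φ.toAlgebra
  (FreeAlgebra.lift R (FreeAlgebra.ι S) :
    FreeAlgebra R (Fin n) →ₐ[R] FreeAlgebra S (Fin n)).toRingHom

theorem mapCoeff_ι (i : Fin n) : mapCoeff φ n (FreeAlgebra.ι R i) = FreeAlgebra.ι S i :=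
  let := φ.toAlgebra
  FreeAlgebra.lift_ι_apply (R := R) (FreeAlgebra.ι S) i

theorem mapCoeff_smul (r : R) (t : FreeAlgebra R (Fin n)) :
    mapCoeff φ n (r • t) = φ r • mapCoeff φ n t := by
  let := φ.toAlgebra
  rw [Algebra.smul_def, map_mul, Algebra.smul_def]
  congr 1
  exact ((FreeAlgebra.lift R (FreeAlgebra.ι S) :
    FreeAlgebra R (Fin n) →ₐ[R] FreeAlgebra S (Fin n)).commutes r).trans
    (IsScalarTower.algebraMap_apply R S _ r)

theorem mapCoeff_word (w : List (Fin n)) : mapCoeff φ n (word R w) = word S w := by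
  induction w with
  | nil => simp
  | cons a w ih => rw [word_cons, map_mul, ih, mapCoeff_ι, word_cons]

theorem word_induction {p : FreeAlgebra R (Fin n) → Prop} (hw : ∀ w, p (word R w))
    (hz : p 0) (ha : ∀ t u, p t → p u → p (t + u)) (hs : ∀ (r : R) t, p t → p (r • t))
    (t : FreeAlgebra R (Fin n)) : p t := by
  have ht : t ∈ Submodule.span R (Set.range (word R (n := n))) := by
    rw [span_range_word]; trivial
  induction ht using Submodule.span_induction with
  | mem t ht => obtain ⟨w, rfl⟩ := ht; exact hw w
  | zero => exact hz
  | add t u _ _ ht hu => exact ha t u ht hu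
  | smul r t _ ht => exact hs r t ht

theorem mapCoeff_wordDeriv (i : Fin n) (t : FreeAlgebra R (Fin n)) :
    mapCoeff φ n (wordDeriv R i t) = wordDeriv S i (mapCoeff φ n t) := by
  induction t using word_induction with
  | hw w =>
    rw [mapCoeff_word, wordDeriv_word, wordDeriv_word, map_sum]
    refine Finset.sum_congr rfl fun j _ => ?_
    rw [cutAt, cutAt]
    split_ifs
    · exact mapCoeff_word φ _
    · exact map_zero _
  | hz => simp
  | ha t u ht hu => simp only [map_add, ht, hu]
  | hs r t ht => rw [map_smul, mapCoeff_smul, mapCoeff_smul, map_smul, ht]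

theorem mapCoeff_comp {Q : Type*} [CommRing Q] (ψ : S →+* Q) (t : FreeAlgebra R (Fin n)) :
    mapCoeff ψ n (mapCoeff φ n t) = mapCoeff (ψ.comp φ) n t := by
  induction t using word_induction with
  | hw w => simp only [mapCoeff_word]
  | hz => simp
  | ha t u ht hu => simp only [map_add, ht, hu]
  | hs r t ht => simp only [mapCoeff_smul, ht, RingHom.comp_apply]

theorem mapCoeff_id (t : FreeAlgebra R (Fin n)) : mapCoeff (RingHom.id R) n t = t := by
  induction t using word_induction with
  | hw w => simp only [mapCoeff_word]
  | hz => simp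
  | ha t u ht hu => simp only [map_add, ht, hu]
  | hs r t ht => simp only [mapCoeff_smul, ht, RingHom.id_apply]

theorem coeffExtend_mk (k : Type*) [Field k] (t : FreeAlgebra k (Fin n)) :
    coeffExtend k n (Submodule.Quotient.mk t) = Submodule.Quotient.mk (mapCoeff C n t) := by
  have : FreeAlgebra.lift k (FreeAlgebra.ι k[X]) t = mapCoeff C n t := by
    induction t using word_induction with
    | hw w =>
      rw [mapCoeff_word, word, word, map_list_prod, List.map_map]
      congr 2
      ext i
      simp
    | hz => simp
    | ha t u ht hu => simp only [map_add, ht, hu]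
    | hs r t ht =>
      rw [map_smul, mapCoeff_smul, ht, ← IsScalarTower.algebraMap_smul k[X] r]
      rfl
  rw [← this]
  rfl

variable {k : Type*} [Field k]

theorem mapCoeff_eval_cyclicDeriv (a : k) (i : Fin 3) (Ψ : CyclicWord k 3) :
    mapCoeff (evalRingHom a) 3 (cyclicDeriv k[X] i (coeffExtend k 3 Ψ)) = cyclicDeriv k i Ψ := by
  obtain ⟨t, rfl⟩ := Submodule.Quotient.mk_surjective _ Ψ
  rw [coeffExtend_mk]
  change mapCoeff _ 3 (wordDeriv k[X] i _) = wordDeriv k i t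
  rw [mapCoeff_wordDeriv, mapCoeff_comp]
  have : (evalRingHom a).comp C = RingHom.id k := by ext; simp
  rw [this, mapCoeff_id]

theorem mapCoeff_eval_relator (N : ℕ) (Φ : ℕ → CyclicWord k 3) (a : k) (i : Fin 3) :
    mapCoeff (evalRingHom a) 3 (relator k[X] (hbarPotential N Φ) i) =
      relator k (potentialAt N Φ a) i := by
  simp only [relator, map_sub, map_mul, mapCoeff_ι, hbarPotential, potentialAt, map_sum, map_smul,
    mapCoeff_smul, mapCoeff_eval_cyclicDeriv, map_pow, coe_evalRingHom, eval_X]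

/-- The quotient of the correction term of the `i`-th relator by `ħ`. -/
def hbarCorrection (N : ℕ) (Φ : ℕ → CyclicWord k 3) (i : Fin 3) : FreeAlgebra k[X] (Fin 3) :=
  ∑ m ∈ Finset.Icc 1 N, (X : k[X]) ^ (m - 1) • cyclicDeriv k[X] i (coeffExtend k 3 (Φ m))

theorem X_smul_hbarCorrection (N : ℕ) (Φ : ℕ → CyclicWord k 3) (i : Fin 3) :
    (X : k[X]) • hbarCorrection N Φ i = cyclicDeriv k[X] i (hbarPotential N Φ) := by
  rw [hbarCorrection, hbarPotential, map_sum, Finset.smul_sum]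
  refine Finset.sum_congr rfl fun m hm => ?_
  -- The sum starts at `m = 1`, so the truncated exponent `m - 1` is an honest one.
  rw [map_smul, smul_smul, ← pow_succ', Nat.sub_add_cancel (Finset.mem_Icc.1 hm).1]

end BaseChange

variable {k : Type*} [Field k]

/-! ### Specialization of the parameter -/

section Specialize

variable (N : ℕ) (Φ : ℕ → CyclicWord k 3) (a : k)

/-- The evaluation `ħ = a` as a homomorphism of algebras with cyclic potential. -/
def evalPotential : HbarAlgebra N Φ →+* PotentialAlgebra k (potentialAt N Φ a) :=
  RingQuot.lift ⟨(toPotential (potentialAt N Φ a)).toRingHom.comp (mapCoeff (evalRingHom a) 3), by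
    rintro _ _ ⟨⟨i, rfl⟩, rfl⟩
    rw [map_zero, RingHom.comp_apply, mapCoeff_eval_relator]
    exact toPotential_relator _ i⟩

theorem evalPotential_toPotential (t : FreeAlgebra k[X] (Fin 3)) :
    evalPotential N Φ a (toPotential _ t) =
      toPotential (potentialAt N Φ a) (mapCoeff (evalRingHom a) 3 t) := by
  have h := RingQuot.lift_mkRingHom_apply
    ((toPotential (potentialAt N Φ a)).toRingHom.comp (mapCoeff (evalRingHom a) 3))
    (r := fun a b : FreeAlgebra k[X] (Fin 3) =>
      (∃ i, a = relator k[X] (hbarPotential N Φ) i) ∧ b = 0) (by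
    rintro _ _ ⟨⟨i, rfl⟩, rfl⟩
    rw [map_zero, RingHom.comp_apply, mapCoeff_eval_relator]
    exact toPotential_relator _ i) t
  rw [← RingQuot.mkAlgHom_coe k[X]] at h
  exact h

theorem mk_eq_smul_one (I : Ideal k[X]) (c : k[X]) :
    Ideal.Quotient.mk I c = c • (1 : k[X] ⧸ I) :=
  congrArg (Ideal.Quotient.mk I) (mul_one c).symm

theorem tmul_mk (z : HbarAlgebra N Φ) (c : k[X]) :
    (z ⊗ₜ[k[X]] (Ideal.Quotient.mk (Ideal.span {(X - C a : k[X])}) c) : Specialization N Φ a)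
      = c.eval a • (z ⊗ₜ 1) := by
  have h : Ideal.Quotient.mk (Ideal.span {(X - C a : k[X])}) c
      = Ideal.Quotient.mk (Ideal.span {(X - C a : k[X])}) (C (c.eval a)) := by
    rw [Ideal.Quotient.eq, Ideal.mem_span_singleton, dvd_iff_isRoot]
    simp
  rw [h, mk_eq_smul_one, ← TensorProduct.smul_tmul, TensorProduct.smul_tmul']
  congr 1

/-- Since `ħ` acts as `a` on the second tensor factor, evaluating coefficients and then lifting is
the same as projecting to `U_ħ(Φ_ħ)` and tensoring with `1`. The relators of `U(Φ(a))` are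
evaluations of those over `k[ħ]`. -/
theorem specGen_relator (i : Fin 3) :
    FreeAlgebra.lift k (specGen N Φ a) (relator k (potentialAt N Φ a) i) = 0 := by
  have key : ∀ t : FreeAlgebra k[X] (Fin 3),
      FreeAlgebra.lift k (specGen N Φ a) (mapCoeff (evalRingHom a) 3 t)
        = toPotential (hbarPotential N Φ) t ⊗ₜ 1 := by
    intro t
    induction t using word_induction with
    | hw w =>
      rw [mapCoeff_word]
      induction w with
      | nil =>
        rw [word_nil, word_nil, map_one (toPotential _)]
        exact (FreeAlgebra.lift k (specGen N Φ a)).map_one'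
      | cons a w ih =>
        rw [word_cons, word_cons, map_mul, map_mul, ih, FreeAlgebra.lift_ι_apply, specGen,
          Algebra.TensorProduct.tmul_mul_tmul, mul_one, toPotential_ι]
    | hz => simp
    | ha t u ht hu => simp only [map_add, ht, hu, TensorProduct.add_tmul]
    | hs r t ht =>
      rw [mapCoeff_smul, map_smul, ht, map_smul, TensorProduct.smul_tmul, coe_evalRingHom,
        ← tmul_mk, mk_eq_smul_one]
  rw [← mapCoeff_eval_relator, key, toPotential_relator, TensorProduct.zero_tmul]

/-- The homomorphism from `U(Φ(a))` to the specialization of `U_ħ(Φ_ħ)` at `ħ = a`. -/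
def toSpecialization : PotentialAlgebra k (potentialAt N Φ a) →ₐ[k] Specialization N Φ a :=
  RingQuot.liftAlgHom k ⟨FreeAlgebra.lift k (specGen N Φ a), by
    rintro _ _ ⟨⟨i, rfl⟩, rfl⟩
    rw [map_zero, specGen_relator]⟩

theorem toSpecialization_toPotential (t : FreeAlgebra k (Fin 3)) :
    toSpecialization N Φ a (toPotential _ t) = FreeAlgebra.lift k (specGen N Φ a) t :=
  RingQuot.liftAlgHom_mkAlgHom_apply k _ _ t

theorem toSpecialization_gen (i : Fin 3) :
    toSpecialization N Φ a (gen k _ i) = specGen N Φ a i := by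
  rw [← toPotential_ι, toSpecialization_toPotential, FreeAlgebra.lift_ι_apply]

theorem toSpecialization_surjective : Function.Surjective (toSpecialization N Φ a) := by
  have key : ∀ t : FreeAlgebra k[X] (Fin 3),
      (toPotential (hbarPotential N Φ) t ⊗ₜ 1 : Specialization N Φ a) ∈
        (toSpecialization N Φ a).range := by
    intro t
    induction t using word_induction with
    | hw w =>
      induction w with
      | nil => rw [word_nil, map_one]; exact one_mem (toSpecialization N Φ a).range
      | cons i w ih =>
        have h : (toPotential (hbarPotential N Φ) (word k[X] (i :: w)) ⊗ₜ 1 :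
            Specialization N Φ a)
            = specGen N Φ a i * (toPotential (hbarPotential N Φ) (word k[X] w) ⊗ₜ 1) := by
          rw [word_cons, map_mul, specGen, Algebra.TensorProduct.tmul_mul_tmul, mul_one,
            toPotential_ι]
        rw [h]
        exact mul_mem ⟨_, toSpecialization_gen N Φ a i⟩ ih
    | hz => rw [map_zero, TensorProduct.zero_tmul]; exact zero_mem _
    | ha t u ht hu => rw [map_add, TensorProduct.add_tmul]; exact add_mem ht hu
    | hs r t ht =>
      have h := tmul_mk N Φ a (toPotential (hbarPotential N Φ) t) r
      rw [map_smul, TensorProduct.smul_tmul, ← mk_eq_smul_one]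
      exact h ▸ Subalgebra.smul_mem _ ht _
  intro z
  change z ∈ (toSpecialization N Φ a).range
  induction z using TensorProduct.induction_on with
  | zero => exact zero_mem _
  | add y z hy hz => exact add_mem hy hz
  | tmul y c =>
    obtain ⟨c, rfl⟩ := Ideal.Quotient.mk_surjective c
    obtain ⟨t, rfl⟩ := toPotential_surjective _ y
    rw [tmul_mk]
    exact Subalgebra.smul_mem _ (key t) _

theorem toSpecialization_injective : Function.Injective (toSpecialization N Φ a) := by
  -- Let `ħ` act on `U(Φ(a))` as the scalar `a`. Evaluation on the first tensor factor and the
  -- structure map on the second then combine to a left inverse `F`.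
  let : Algebra k[X] (PotentialAlgebra k (potentialAt N Φ a)) :=
    ((algebraMap k _).comp (evalRingHom a)).toAlgebra' fun c x => Algebra.commutes _ _
  let f : HbarAlgebra N Φ →ₐ[k[X]] PotentialAlgebra k (potentialAt N Φ a) :=
    { evalPotential N Φ a with
      commutes' := fun r => by
        have h := evalPotential_toPotential N Φ a (r • 1)
        rw [mapCoeff_smul, map_smul (toPotential _), map_smul (toPotential _), map_one, map_one,
          map_one] at h
        exact (congrArg _ (Algebra.algebraMap_eq_smul_one r)).trans
          (h.trans (Algebra.algebraMap_eq_smul_one (eval a r)).symm) }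
  let g : (k[X] ⧸ Ideal.span {(X - C a : k[X])}) →ₐ[k[X]]
      PotentialAlgebra k (potentialAt N Φ a) :=
    Ideal.Quotient.liftₐ _ (Algebra.ofId k[X] _) (by
      intro c hc
      rw [Ideal.mem_span_singleton, dvd_iff_isRoot] at hc
      change algebraMap k _ (eval a c) = 0
      rw [hc.eq_zero, map_zero])
  let F : Specialization N Φ a →ₐ[k[X]] PotentialAlgebra k (potentialAt N Φ a) :=
    Algebra.TensorProduct.lift f g fun x c => by
      obtain ⟨c, rfl⟩ := Ideal.Quotient.mk_surjective c
      exact (Algebra.commutes c (f x)).symm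
  have hF : ∀ x, F (toSpecialization N Φ a x) = x := by
    intro x
    obtain ⟨t, rfl⟩ := toPotential_surjective _ x
    rw [toSpecialization_toPotential]
    induction t using word_induction with
    | hw w =>
      induction w with
      | nil =>
        rw [word_nil, map_one (toPotential _)]
        exact (congrArg F (FreeAlgebra.lift k (specGen N Φ a)).map_one').trans F.map_one'
      | cons i w ih =>
        rw [word_cons, map_mul, map_mul, map_mul, ih, FreeAlgebra.lift_ι_apply]
        congr 1
        change F (gen k[X] (hbarPotential N Φ) i ⊗ₜ 1) = _
        rw [Algebra.TensorProduct.lift_tmul, map_one, mul_one]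
        have h := evalPotential_toPotential N Φ a (FreeAlgebra.ι k[X] i)
        rw [mapCoeff_ι] at h
        exact h
    | hz => simp
    | ha t u ht hu => simp only [map_add, ht, hu]
    | hs r t ht =>
      have h1 : FreeAlgebra.lift k (specGen N Φ a) (r • t) =
          (C r : k[X]) • FreeAlgebra.lift k (specGen N Φ a) t :=
        (map_smul _ r t).trans (algebraMap_smul k[X] r _).symm
      rw [h1, map_smul, ht, map_smul, Algebra.smul_def, Algebra.smul_def]
      congr 1
      change algebraMap k _ (eval a (C r)) = _
      rw [eval_C]
  exact Function.LeftInverse.injective hF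

/-- The isomorphism of the specialization of `U_ħ(Φ_ħ)` at `ħ = a` with `U(Φ(a))`. -/
def specializationEquiv :
    Specialization N Φ a ≃ₐ[k] PotentialAlgebra k (potentialAt N Φ a) :=
  (AlgEquiv.ofBijective (toSpecialization N Φ a)
    ⟨toSpecialization_injective N Φ a, toSpecialization_surjective N Φ a⟩).symm

theorem specializationEquiv_symm_apply (x : PotentialAlgebra k (potentialAt N Φ a)) :
    (specializationEquiv N Φ a).symm x = toSpecialization N Φ a x := rfl

theorem specializationEquiv_specGen (i : Fin 3) :
    specializationEquiv N Φ a (specGen N Φ a i) = gen k (potentialAt N Φ a) i := by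
  rw [← toSpecialization_gen, ← specializationEquiv_symm_apply, AlgEquiv.apply_symm_apply]

end Specialize

/-! ### The descending filtration -/

section TorsionFree

variable {n : ℕ}

theorem smul_left_cancel_of_ne_zero {R : Type*} [CommRing R] [IsDomain R] {r : R} (hr : r ≠ 0)
    {t u : FreeAlgebra R (Fin n)} (h : r • t = r • u) : t = u := by
  apply (FreeAlgebra.basisFreeMonoid R (Fin n)).repr.injective
  ext w
  have := congrArg (fun z => (FreeAlgebra.basisFreeMonoid R (Fin n)).repr z w) h
  simpa [hr] using this

theorem abelianize_mapCoeff {R S : Type*} [CommRing R] [CommRing S] (φ : R →+* S)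
    (t : FreeAlgebra R (Fin n)) :
    abelianize S n (mapCoeff φ n t) = MvPolynomial.map φ (abelianize R n t) := by
  induction t using word_induction with
  | hw w => simp [mapCoeff_word, abelianize_word, MvPolynomial.map_monomial]
  | hz => simp
  | ha t u ht hu => simp only [map_add, ht, hu]
  | hs r t ht =>
    rw [mapCoeff_smul, map_smul, map_smul, ht, MvPolynomial.smul_eq_C_mul,
      MvPolynomial.smul_eq_C_mul, map_mul, MvPolynomial.map_C]

end TorsionFree

/-! ### Regularity of the parameter and reduction modulo it -/

section Hbar

variable (N : ℕ) (Φ : ℕ → CyclicWord k 3)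

theorem relator_hbar (i : Fin 3) : relator k[X] (hbarPotential N Φ) i =
    FreeAlgebra.ι k[X] (i + 1) * FreeAlgebra.ι k[X] (i + 2)
      - FreeAlgebra.ι k[X] (i + 2) * FreeAlgebra.ι k[X] (i + 1)
      - (X : k[X]) • hbarCorrection N Φ i := by
  rw [X_smul_hbarCorrection]
  rfl

theorem isDeformation_hbar : IsDeformation (X : k[X]) (relatorArray (hbarPotential N Φ))
    (crossArray (hbarCorrection N Φ)) (fun _ => ⊤)
    (fun _ => relSpan (relatorArray (hbarPotential N Φ)) Set.univ) :=
  .of_relations (crossArray_eq (relator_hbar N Φ)) (crossArray_antisymm _)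
    (crossArray_jacobi (sum_relator_comm _))

/-- Torsion-freeness of the quotient. Writing `ħ t` through `exists_sorting_eq` gives `sorting (ħ (t
+ z)) = ħ (t + y)` with `y` in the ideal. The free algebra has no `ħ`-torsion, so `t = sorting (t +
z) - y`, and `sorting` takes values in the ideal. -/
theorem mem_relSpan_of_X_smul_mem {t : FreeAlgebra k[X] (Fin 3)}
    (ht : (X : k[X]) • t ∈ relSpan (relatorArray (hbarPotential N Φ)) Set.univ) :
    t ∈ relSpan (relatorArray (hbarPotential N Φ)) Set.univ := by
  have D := isDeformation_hbar N Φ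
  obtain ⟨c, -, ⟨y, hy, e⟩, z, -, f⟩ := D.exists_sorting_eq (U := relSpan _ Set.univ) (V := ⊤)
    (crossArray_self _) (fun _ _ _ => le_rfl) (fun _ _ _ => le_rfl) (fun _ _ _ => trivial) ht
  rw [f, ← smul_add, ← smul_add, map_smul] at e
  have h := smul_left_cancel_of_ne_zero X_ne_zero e
  rw [← add_sub_cancel_right t y, ← h]
  refine sub_mem (D.sorting_mem (s := Set.univ) (fun _ _ => le_rfl) ?_) hy
  rw [Set.image_univ, span_range_word]
  trivial

/-- The parameter `ħ` as an element of `U_ħ(Φ_ħ)`. -/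
abbrev hbar : HbarAlgebra N Φ := algebraMap k[X] (HbarAlgebra N Φ) X

theorem hbar_mul_toPotential (t : FreeAlgebra k[X] (Fin 3)) :
    hbar N Φ * toPotential _ t = toPotential _ ((X : k[X]) • t) := by
  rw [map_smul, Algebra.smul_def]

theorem hbar_mul_injective : Function.Injective (hbar N Φ * ·) := by
  refine (injective_iff_map_eq_zero (AddMonoidHom.mulLeft (hbar N Φ))).2 fun x hx => ?_
  obtain ⟨t, rfl⟩ := toPotential_surjective _ x
  change hbar N Φ * _ = 0 at hx
  rw [hbar_mul_toPotential, toPotential_eq_zero_iff] at hx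
  rw [toPotential_eq_zero_iff]
  exact mem_relSpan_of_X_smul_mem N Φ hx

theorem hbar_pow_mul_injective (l : ℕ) : Function.Injective (hbar N Φ ^ l * ·) := by
  induction l with
  | zero => intro x y h; simpa using h
  | succ l ih =>
    intro x y h
    simp only [pow_succ', mul_assoc] at h
    exact ih (hbar_mul_injective N Φ h)

theorem potentialAt_zero : potentialAt N Φ 0 = 0 := by
  rw [potentialAt]
  refine Finset.sum_eq_zero fun m hm => ?_
  rw [zero_pow (by have := (Finset.mem_Icc.1 hm).1; omega), zero_smul]

/-- The reduction of `U_ħ(Φ_ħ)` modulo `ħ`. -/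
def classicalRingHom : HbarAlgebra N Φ →+* MvPolynomial (Fin 3) k :=
  RingQuot.lift ⟨(abelianize k 3).toRingHom.comp (mapCoeff (evalRingHom 0) 3), by
    rintro _ _ ⟨⟨i, rfl⟩, rfl⟩
    rw [map_zero, RingHom.comp_apply, mapCoeff_eval_relator, potentialAt_zero]
    change abelianize k 3 _ = 0
    simp [relator, mul_comm]⟩

theorem classicalRingHom_toPotential (t : FreeAlgebra k[X] (Fin 3)) :
    classicalRingHom N Φ (toPotential _ t) = abelianize k 3 (mapCoeff (evalRingHom 0) 3 t) := by
  have h := RingQuot.lift_mkRingHom_apply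
    ((abelianize k 3).toRingHom.comp (mapCoeff (evalRingHom 0) 3))
    (r := fun a b : FreeAlgebra k[X] (Fin 3) =>
      (∃ i, a = relator k[X] (hbarPotential N Φ) i) ∧ b = 0) (by
    rintro _ _ ⟨⟨i, rfl⟩, rfl⟩
    rw [map_zero, RingHom.comp_apply, mapCoeff_eval_relator, potentialAt_zero]
    change abelianize k 3 _ = 0
    simp [relator, mul_comm]) t
  rw [← RingQuot.mkAlgHom_coe k[X]] at h
  exact h

theorem classicalRingHom_algebraMap (c : k[X]) :
    classicalRingHom N Φ (algebraMap k[X] _ c) = MvPolynomial.C (c.eval 0) := by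
  have h := classicalRingHom_toPotential N Φ (c • 1)
  rw [map_smul (toPotential _), map_one (toPotential _), mapCoeff_smul, map_one,
    map_smul (abelianize k 3), map_one] at h
  rw [Algebra.algebraMap_eq_smul_one, h, MvPolynomial.smul_eq_C_mul, mul_one, coe_evalRingHom]

/-- The reduction of `U_ħ(Φ_ħ)` modulo `ħ`, as a homomorphism of `k`-algebras. -/
def classical : HbarAlgebra N Φ →ₐ[k] MvPolynomial (Fin 3) k :=
  { classicalRingHom N Φ with
    commutes' := fun c => by
      have h := classicalRingHom_algebraMap N Φ (C c)
      rw [eval_C] at h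
      exact (congrArg _ (IsScalarTower.algebraMap_apply k k[X] (HbarAlgebra N Φ) c)).trans h }

theorem classical_toPotential (t : FreeAlgebra k[X] (Fin 3)) :
    classical N Φ (toPotential _ t) = abelianize k 3 (mapCoeff (evalRingHom 0) 3 t) :=
  classicalRingHom_toPotential N Φ t

theorem classical_gen (i : Fin 3) :
    classical N Φ (gen k[X] (hbarPotential N Φ) i) = MvPolynomial.X i := by
  rw [← toPotential_ι, classical_toPotential, mapCoeff_ι]
  simp [abelianize]

theorem classical_surjective : Function.Surjective (classical N Φ) := by
  intro f
  refine ⟨toPotential _ (mapCoeff C 3 (orderedLift (FreeAlgebra.ι k) f)), ?_⟩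
  have : (evalRingHom (0 : k)).comp C = RingHom.id k := by ext; simp
  rw [classical_toPotential, mapCoeff_comp, this, mapCoeff_id, abelianize_orderedLift]

/-- Modulo relations and multiples of `ħ`, an element equals the ordered lift of its abelianization.
If the class at `ħ = 0` vanishes, every coefficient of the abelianization is divisible by `ħ`, and
so is the whole element. -/
theorem classical_eq_zero_iff (x : HbarAlgebra N Φ) :
    classical N Φ x = 0 ↔ ∃ y, hbar N Φ * y = x := by
  constructor
  · obtain ⟨t, rfl⟩ := toPotential_surjective _ x
    intro ht
    have D := isDeformation_hbar N Φ
    have htop : t ∈ Submodule.span k[X] (word k[X] '' Set.univ) := by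
      rw [Set.image_univ, span_range_word]
      trivial
    obtain ⟨y, -, e⟩ := D.sorting_add_orderedLift (V := ⊤) (fun _ _ => le_rfl) htop
    have hP := (toPotential_eq_zero_iff _ _).2 (D.sorting_mem (fun _ _ => le_rfl) htop)
    rw [classical_toPotential, abelianize_mapCoeff] at ht
    have hd : MvPolynomial.C (X : k[X]) ∣ abelianize k[X] 3 t := by
      rw [MvPolynomial.C_dvd_iff_dvd_coeff]
      intro α
      have := congrArg (MvPolynomial.coeff α) ht
      rw [MvPolynomial.coeff_map, MvPolynomial.coeff_zero, coe_evalRingHom] at this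
      rwa [X_dvd_iff, coeff_zero_eq_eval_zero]
    obtain ⟨f, hf⟩ := hd
    rw [hf, ← MvPolynomial.smul_eq_C_mul, map_smul] at e
    refine ⟨toPotential _ (orderedLift (FreeAlgebra.ι k[X]) f - y), ?_⟩
    rw [hbar_mul_toPotential, smul_sub, map_sub, sub_eq_iff_eq_add, ← map_add, ← e, map_add, hP,
      zero_add]
  · rintro ⟨y, rfl⟩
    rw [map_mul]
    have : classical N Φ (hbar N Φ) = 0 :=
      (classicalRingHom_algebraMap N Φ X).trans (by simp)
    rw [this, zero_mul]

end Hbar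

theorem toAlgebra_of {R : Type*} [CommSemiring R] {A : ℕ → Type*} [∀ i, AddCommMonoid (A i)]
    [∀ i, Module R (A i)] [DirectSum.GSemiring A] [DirectSum.GAlgebra R A] {B : Type*} [Semiring B]
    [Algebra R B] (f : ∀ i, A i →ₗ[R] B) (hone : f 0 GradedMonoid.GOne.one = 1)
    (hmul : ∀ {i j} (u : A i) (v : A j), f (i + j) (GradedMonoid.GMul.mul u v) = f i u * f j v)
    (i : ℕ) (u : A i) :
    DirectSum.toAlgebra R A f hone hmul (DirectSum.of A i u) = f i u :=
  DirectSum.toSemiring_of (fun i => (f i).toAddMonoidHom) hone hmul i u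

/-! ### The associated graded algebra of the descending filtration -/

section GradedPieces

variable {A : Type*} [Ring A] [Algebra k A] [Algebra k[X] A] {n : ℕ}
  (π : A →ₐ[k] MvPolynomial (Fin n) k)
  (hinj : ∀ l, Function.Injective (LinearMap.mulLeft k (algebraMap k[X] A X ^ l)))
  (hker : ∀ x, π x = 0 ↔ ∃ y, algebraMap k[X] A X * y = x)

/-- The identification of `ħ ^ l A / ħ ^ (l + 1) A` with the polynomial algebra. -/
def pieceToPoly (l : ℕ) : (hbarFiltration k (A := A)).Piece l →ₗ[k] MvPolynomial (Fin n) k :=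
  Submodule.liftQ (((hbarFiltration k (A := A)).G l).submoduleOf ((hbarFiltration k (A := A)).F l))
    (π.toLinearMap ∘ₗ (LinearEquiv.ofInjective _ (hinj l)).symm.toLinearMap) (by
    rintro ⟨_, hx⟩ hG
    obtain ⟨y, rfl⟩ : _ ∈ LinearMap.range
      (LinearMap.mulLeft k (algebraMap k[X] A X ^ (l + 1))) := hG
    -- The unique quotient of `ħ ^ (l + 1) y` by `ħ ^ l` is `ħ y`, which `π` kills.
    have : (⟨_, hx⟩ : LinearMap.range (LinearMap.mulLeft k (algebraMap k[X] A X ^ l))) =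
        LinearEquiv.ofInjective _ (hinj l) (algebraMap k[X] A X * y) := by
      ext
      simp [pow_succ]
    have h : π ((LinearEquiv.ofInjective _ (hinj l)).symm
        (⟨_, hx⟩ : LinearMap.range (LinearMap.mulLeft k (algebraMap k[X] A X ^ l)))) = 0 := by
      rw [this, LinearEquiv.symm_apply_apply, hker]
      exact ⟨y, rfl⟩
    exact h)

theorem hbar_pow_mul_mem (l : ℕ) (x : A) :
    algebraMap k[X] A X ^ l * x ∈ (hbarFiltration k (A := A)).F l := ⟨x, rfl⟩

theorem pieceToPoly_cls {l : ℕ} {x y : A} (hy : y ∈ (hbarFiltration k (A := A)).F l)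
    (h : algebraMap k[X] A X ^ l * x = y) :
    pieceToPoly π hinj hker l ((hbarFiltration k (A := A)).cls l y hy) = π x := by
  subst h
  change π ((LinearEquiv.ofInjective _ (hinj l)).symm
    (LinearEquiv.ofInjective _ (hinj l) x)) = _
  rw [LinearEquiv.symm_apply_apply]

theorem exists_eq_cls (l : ℕ) (u : (hbarFiltration k (A := A)).Piece l) :
    ∃ x, u = (hbarFiltration k (A := A)).cls l _ (hbar_pow_mul_mem l x) := by
  obtain ⟨_, ⟨x, rfl⟩, rfl⟩ := (hbarFiltration k (A := A)).exists_cls u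
  exact ⟨x, rfl⟩

theorem pieceToPoly_injective (l : ℕ) : Function.Injective (pieceToPoly π hinj hker l) := by
  refine (injective_iff_map_eq_zero _).2 fun u hu => ?_
  obtain ⟨x, rfl⟩ := exists_eq_cls l u
  rw [pieceToPoly_cls _ _ _ _ rfl, hker] at hu
  obtain ⟨y, rfl⟩ := hu
  refine ((hbarFiltration k (A := A)).cls_eq_iff _ (zero_mem _)).2 ?_
  rw [sub_zero, ← mul_assoc, ← pow_succ]
  exact ⟨y, rfl⟩

theorem pieceToPoly_mul {i j : ℕ} (u : (hbarFiltration k (A := A)).Piece i)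
    (v : (hbarFiltration k (A := A)).Piece j) :
    pieceToPoly π hinj hker (i + j) (GradedMonoid.GMul.mul u v) =
      pieceToPoly π hinj hker i u * pieceToPoly π hinj hker j v := by
  obtain ⟨x, rfl⟩ := exists_eq_cls i u
  obtain ⟨y, rfl⟩ := exists_eq_cls j v
  rw [pieceToPoly_cls _ _ _ _ rfl, pieceToPoly_cls _ _ _ _ rfl, ← map_mul]
  refine pieceToPoly_cls π hinj hker _ ?_
  have h : algebraMap k[X] A X ^ j * x = x * algebraMap k[X] A X ^ j := by
    rw [← map_pow]
    exact Algebra.commutes _ _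
  rw [pow_add, mul_assoc, ← mul_assoc (algebraMap k[X] A X ^ j), h]
  simp only [mul_assoc]

theorem monomial_pieceToPoly_mul {i j : ℕ} (u : (hbarFiltration k (A := A)).Piece i)
    (v : (hbarFiltration k (A := A)).Piece j) :
    monomial (i + j) (pieceToPoly π hinj hker (i + j) (GradedMonoid.GMul.mul u v)) =
      monomial i (pieceToPoly π hinj hker i u) * monomial j (pieceToPoly π hinj hker j v) := by
  rw [pieceToPoly_mul, monomial_mul_monomial]

/-- The homomorphism from the associated graded algebra to `S(V)[ħ]`. -/
def grToPoly : (hbarFiltration k (A := A)).Gr →ₐ[k] (MvPolynomial (Fin n) k)[X] :=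
  DirectSum.toAlgebra k _
    (fun l => ((monomial l).restrictScalars k) ∘ₗ pieceToPoly π hinj hker l)
    (by
      have h : pieceToPoly π hinj hker 0 GradedMonoid.GOne.one = π 1 :=
        pieceToPoly_cls π hinj hker (hbarFiltration k (A := A)).one_mem (by simp)
      rw [map_one] at h
      change monomial 0 (pieceToPoly π hinj hker 0 GradedMonoid.GOne.one) = 1
      rw [h]
      rfl)
    (monomial_pieceToPoly_mul π hinj hker)

theorem grToPoly_of (l : ℕ) (u : (hbarFiltration k (A := A)).Piece l) :
    grToPoly π hinj hker (DirectSum.of _ l u) = monomial l (pieceToPoly π hinj hker l u) := by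
  rw [grToPoly, toAlgebra_of _ _ (monomial_pieceToPoly_mul π hinj hker)]
  rfl

theorem coeff_grToPoly (x : (hbarFiltration k (A := A)).Gr) (l : ℕ) :
    (grToPoly π hinj hker x).coeff l = pieceToPoly π hinj hker l (x l) := by
  induction x using DirectSum.induction_on with
  | zero => simp
  | of i u =>
    rw [grToPoly_of, coeff_monomial]
    split_ifs with h
    · subst h
      rw [DirectSum.of_eq_same]
    · rw [DirectSum.of_eq_of_ne _ _ _ (Ne.symm h), map_zero]
  | add x y hx hy => rw [map_add, coeff_add, hx, hy, DirectSum.add_apply, map_add]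

theorem grToPoly_bijective (hsurj : Function.Surjective π) :
    Function.Bijective (grToPoly π hinj hker) := by
  constructor
  · refine (injective_iff_map_eq_zero _).2 fun x hx => ?_
    refine DFinsupp.ext fun l => pieceToPoly_injective π hinj hker l ?_
    have := coeff_grToPoly π hinj hker x l
    rw [hx, coeff_zero] at this
    rw [← this, DirectSum.zero_apply, map_zero]
  · intro p
    induction p using Polynomial.induction_on' with
    | add p q hp hq =>
      obtain ⟨x, rfl⟩ := hp
      obtain ⟨y, rfl⟩ := hq
      exact ⟨x + y, map_add _ _ _⟩
    | monomial l f =>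
      obtain ⟨x, rfl⟩ := hsurj f
      exact ⟨DirectSum.of _ l ((hbarFiltration k (A := A)).cls l _ (hbar_pow_mul_mem l x)), by
        rw [grToPoly_of, pieceToPoly_cls _ _ _ _ rfl]⟩

include hinj hker in
-- Only two facts about `A` matter: `ħ` is regular, and `π` identifies `A / ħ A` with the polynomial
-- algebra. Division by `ħ ^ l` followed by `π` is then an isomorphism on each graded piece, and
-- these are multiplicative because `ħ` is central.
theorem isDescendingPBW_of_reduction (hsurj : Function.Surjective π) {x : Fin n → A}
    (hx : ∀ i, π (x i) = MvPolynomial.X i) : IsDescendingPBW k x := by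
  refine ⟨AlgEquiv.ofBijective (grToPoly π hinj hker) (grToPoly_bijective π hinj hker hsurj),
    fun l u => ⟨_, grToPoly_of π hinj hker l u⟩, ?_, fun i => ?_⟩
  · refine (grToPoly_of π hinj hker 1 _).trans ?_
    rw [pieceToPoly_cls π hinj hker (x := 1) _ (by simp), map_one]
    rfl
  · refine (grToPoly_of π hinj hker 0 _).trans ?_
    rw [pieceToPoly_cls π hinj hker (x := x i) _ (by simp), hx]
    rfl

end GradedPieces

theorem isDescendingPBW_gen (N : ℕ) (Φ : ℕ → CyclicWord k 3) :
    IsDescendingPBW k (gen k[X] (hbarPotential N Φ)) :=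
  isDescendingPBW_of_reduction (classical N Φ) (hbar_pow_mul_injective N Φ)
    (classical_eq_zero_iff N Φ) (classical_surjective N Φ) (classical_gen N Φ)

/-! ### A criterion for the Poincaré-Birkhoff-Witt property -/

section Criterion

variable {R : Type*} [CommRing R] {A : Type*} [Ring A] [Algebra R A] {n : ℕ} {x : Fin n → A}

theorem orderedLift_eq_sum (f : MvPolynomial (Fin n) R) :
    orderedLift x f = ∑ α ∈ f.support, f.coeff α • orderedMonomial x α := by
  conv_lhs => rw [f.as_sum]
  rw [map_sum]
  refine Finset.sum_congr rfl fun α _ => ?_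
  rw [← orderedLift_monomial (R := R), ← map_smul, MvPolynomial.smul_monomial, smul_eq_mul, mul_one]

theorem exists_orderedLift_eq
    (hspan : ∀ d, wordSpan R x d ≤ Submodule.span R (orderedMonomial x '' {α | α.degree ≤ d}))
    {d : ℕ} {a : A} (ha : a ∈ wordSpan R x d) :
    ∃ f : MvPolynomial (Fin n) R, f.totalDegree ≤ d ∧ orderedLift x f = a := by
  have ha' := hspan d ha
  clear ha
  induction ha' using Submodule.span_induction with
  | mem a ha =>
    obtain ⟨α, hα, rfl⟩ := ha
    refine ⟨MvPolynomial.monomial α 1, (MvPolynomial.totalDegree_monomial_le _ _).trans ?_,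
      orderedLift_monomial x α⟩
    exact hα
  | zero => exact ⟨0, by simp, map_zero _⟩
  | add a b _ _ ha hb =>
    obtain ⟨f, hf, rfl⟩ := ha
    obtain ⟨g, hg, rfl⟩ := hb
    exact ⟨f + g, (MvPolynomial.totalDegree_add _ _).trans (max_le hf hg), map_add _ _ _⟩
  | smul r a _ ha =>
    obtain ⟨f, hf, rfl⟩ := ha
    exact ⟨r • f, (MvPolynomial.totalDegree_smul_le _ _).trans hf, map_smul _ _ _⟩

theorem orderedLift_mem_wordSpanPred {d : ℕ} {f : MvPolynomial (Fin n) R}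
    (hf : ∀ α ∈ f.support, α.degree < d) : orderedLift x f ∈ wordSpanPred R x d := by
  rw [orderedLift_eq_sum]
  refine Submodule.sum_mem _ fun α hα => Submodule.smul_mem _ _ ?_
  have h := hf α hα
  obtain ⟨d, rfl⟩ : ∃ e, d = e + 1 := ⟨d - 1, by omega⟩
  exact wordSpan_mono R x (by omega) (orderedMonomial_mem R x α)

theorem exists_of_mem_wordSpanPred
    (hspan : ∀ d, wordSpan R x d ≤ Submodule.span R (orderedMonomial x '' {α | α.degree ≤ d}))
    {d : ℕ} {a : A} (ha : a ∈ wordSpanPred R x d) :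
    ∃ f : MvPolynomial (Fin n) R,
      MvPolynomial.homogeneousComponent d f = 0 ∧ orderedLift x f = a := by
  cases d with
  | zero => exact ⟨0, map_zero _, by rw [map_zero, (Submodule.mem_bot R).1 ha]⟩
  | succ d =>
    obtain ⟨f, hf, rfl⟩ := exists_orderedLift_eq hspan ha
    exact ⟨f, MvPolynomial.homogeneousComponent_eq_zero _ _ (by omega), rfl⟩

variable (hli : Function.Injective (orderedLift x : MvPolynomial (Fin n) R →ₗ[R] A))
  (hspan : ∀ d, wordSpan R x d ≤ Submodule.span R (orderedMonomial x '' {α | α.degree ≤ d}))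

/-- The leading term of an element of degree at most `d`. -/
def leadingTerm (d : ℕ) : wordSpan R x d →ₗ[R] MvPolynomial (Fin n) R :=
  MvPolynomial.homogeneousComponent d ∘ₗ (LinearEquiv.ofInjective _ hli).symm.toLinearMap ∘ₗ
    Submodule.inclusion (fun a ha => by
      obtain ⟨f, -, hf⟩ := exists_orderedLift_eq hspan ha
      exact ⟨f, hf⟩ : wordSpan R x d ≤ LinearMap.range (orderedLift (R := R) x))

theorem leadingTerm_apply {d : ℕ} {a : A} (ha : a ∈ wordSpan R x d)
    {f : MvPolynomial (Fin n) R} (hf : orderedLift x f = a) :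
    leadingTerm hli hspan d ⟨a, ha⟩ = MvPolynomial.homogeneousComponent d f := by
  subst hf
  change MvPolynomial.homogeneousComponent d ((LinearEquiv.ofInjective _ hli).symm
    (LinearEquiv.ofInjective _ hli f)) = _
  rw [LinearEquiv.symm_apply_apply]

/-- The leading term as a map on the pieces of the associated graded algebra. -/
def pieceLeadingTerm (d : ℕ) :
    (degreeFiltration R x).Piece d →ₗ[R] MvPolynomial (Fin n) R :=
  Submodule.liftQ (((degreeFiltration R x).G d).submoduleOf ((degreeFiltration R x).F d))
    (leadingTerm hli hspan d) (by
      rintro ⟨a, ha⟩ hG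
      obtain ⟨f, hf, rfl⟩ := exists_of_mem_wordSpanPred hspan hG
      exact (leadingTerm_apply hli hspan ha rfl).trans hf)

theorem pieceLeadingTerm_cls {d : ℕ} {a : A} (ha : a ∈ (degreeFiltration R x).F d)
    {f : MvPolynomial (Fin n) R} (hf : orderedLift x f = a) :
    pieceLeadingTerm hli hspan d ((degreeFiltration R x).cls d a ha) =
      MvPolynomial.homogeneousComponent d f :=
  leadingTerm_apply hli hspan ha hf

/-- A polynomial of degree at most `d` with zero component in degree `d` involves only monomials of
degree below `d`, whose ordered lifts lie in the preceding filtration step. -/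
theorem pieceLeadingTerm_injective (d : ℕ) :
    Function.Injective (pieceLeadingTerm hli hspan d) := by
  refine (injective_iff_map_eq_zero _).2 fun u hu => ?_
  obtain ⟨a, ha, rfl⟩ := (degreeFiltration R x).exists_cls u
  obtain ⟨f, hd, rfl⟩ := exists_orderedLift_eq hspan ha
  rw [pieceLeadingTerm_cls hli hspan ha rfl] at hu
  refine ((degreeFiltration R x).cls_eq_iff _ (zero_mem _)).2 ?_
  rw [sub_zero]
  refine orderedLift_mem_wordSpanPred fun α hα => ?_
  refine lt_of_le_of_ne ((MvPolynomial.le_totalDegree hα).trans hd) fun h => ?_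
  have := congrArg (MvPolynomial.coeff α) hu
  rw [MvPolynomial.coeff_homogeneousComponent, if_pos h, MvPolynomial.coeff_zero] at this
  exact MvPolynomial.mem_support_iff.1 hα this

theorem pieceLeadingTerm_isHomogeneous (d : ℕ) (u : (degreeFiltration R x).Piece d) :
    (pieceLeadingTerm hli hspan d u).IsHomogeneous d := by
  obtain ⟨a, ha, rfl⟩ := (degreeFiltration R x).exists_cls u
  obtain ⟨f, -, rfl⟩ := exists_orderedLift_eq hspan ha
  rw [pieceLeadingTerm_cls hli hspan ha rfl]
  exact MvPolynomial.homogeneousComponent_isHomogeneous d f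

/-- The linear map from the associated graded algebra to the polynomial algebra given by leading
terms. -/
def grLeadingTerm : (degreeFiltration R x).Gr →ₗ[R] MvPolynomial (Fin n) R :=
  DirectSum.toModule R ℕ _ (pieceLeadingTerm hli hspan)

theorem grLeadingTerm_of (d : ℕ) (u : (degreeFiltration R x).Piece d) :
    grLeadingTerm hli hspan (DirectSum.of _ d u) = pieceLeadingTerm hli hspan d u :=
  DirectSum.toModule_lof R d u

theorem homogeneousComponent_grLeadingTerm (u : (degreeFiltration R x).Gr) (d : ℕ) :
    MvPolynomial.homogeneousComponent d (grLeadingTerm hli hspan u) =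
      pieceLeadingTerm hli hspan d (u d) := by
  induction u using DirectSum.induction_on with
  | zero => simp
  | of i u =>
    rw [grLeadingTerm_of,
      MvPolynomial.homogeneousComponent_of_mem (pieceLeadingTerm_isHomogeneous hli hspan i u)]
    split_ifs with h
    · subst h
      rw [DirectSum.of_eq_same]
    · rw [DirectSum.of_eq_of_ne _ _ _ h, map_zero]
  | add u v hu hv => rw [map_add, map_add, hu, hv, DirectSum.add_apply, map_add]

theorem grLeadingTerm_symb (α : Fin n →₀ ℕ) :
    grLeadingTerm hli hspan ((degreeFiltration R x).symb α.degree (orderedMonomial x α)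
      (orderedMonomial_mem R x α)) = MvPolynomial.monomial α 1 := by
  refine (grLeadingTerm_of hli hspan _ _).trans ?_
  refine (pieceLeadingTerm_cls hli hspan _ (orderedLift_monomial x α)).trans ?_
  rw [MvPolynomial.homogeneousComponent_of_mem (MvPolynomial.isHomogeneous_monomial 1 rfl),
    if_pos rfl]

theorem grLeadingTerm_bijective : Function.Bijective (grLeadingTerm hli hspan) := by
  constructor
  · refine (injective_iff_map_eq_zero _).2 fun u hu => ?_
    refine DFinsupp.ext fun d => pieceLeadingTerm_injective hli hspan d ?_
    have := homogeneousComponent_grLeadingTerm hli hspan u d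
    rw [hu, map_zero] at this
    rw [← this, DirectSum.zero_apply, map_zero]
  · rw [← LinearMap.range_eq_top, eq_top_iff,
      ← (MvPolynomial.basisMonomials (Fin n) R).span_eq, Submodule.span_le]
    rintro _ ⟨α, rfl⟩
    rw [MvPolynomial.coe_basisMonomials]
    exact ⟨_, grLeadingTerm_symb hli hspan α⟩

variable (R) in
theorem ι_mem_wordSpan (x : Fin n → A) (i : Fin n) : x i ∈ (degreeFiltration R x).F 1 :=
  Submodule.subset_span ⟨[i], by simp, by simp⟩

variable (R) in
theorem prod_mem_wordSpan (x : Fin n → A) (w : List (Fin n)) :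
    (w.map x).prod ∈ (degreeFiltration R x).F w.length :=
  Submodule.subset_span ⟨w, le_rfl, rfl⟩

theorem symb_congr {T : AlgFiltration R A} {i j : ℕ} (hij : i = j) {a b : A} (ha : a ∈ T.F i)
    (hb : b ∈ T.F j) (hab : a = b) : T.symb i a ha = T.symb j b hb :=
  DirectSum.of_eq_of_gradedMonoid_eq (T.mk_cls_eq hij ha hb hab)

theorem prod_symb (w : List (Fin n)) :
    (w.map fun i => (degreeFiltration R x).symb 1 (x i) (ι_mem_wordSpan R x i)).prod =
      (degreeFiltration R x).symb w.length (w.map x).prod (prod_mem_wordSpan R x w) := by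
  induction w with
  | nil => rfl
  | cons i w ih =>
    rw [List.map_cons, List.prod_cons, ih]
    refine (DirectSum.of_mul_of _ _).trans ?_
    exact symb_congr (by simp [add_comm])
      ((degreeFiltration R x).mul_mem (ι_mem_wordSpan R x i) (prod_mem_wordSpan R x w)) _ (by simp)

theorem symb_orderedMonomial (α : Fin n →₀ ℕ) :
    (degreeFiltration R x).symb α.degree (orderedMonomial x α) (orderedMonomial_mem R x α) =
      ((sortedWord α).map fun i =>
        (degreeFiltration R x).symb 1 (x i) (ι_mem_wordSpan R x i)).prod := by
  rw [prod_symb]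
  exact symb_congr (length_sortedWord α).symm _ _ (orderedMonomial_eq x α)

/-- The class of an ordered monomial is a product of degree-one classes, so commutativity lets the
two lists of factors be merged in order. -/
theorem symb_orderedMonomial_mul (hcomm : ∀ u v : (degreeFiltration R x).Gr, u * v = v * u)
    (α β : Fin n →₀ ℕ) :
    (degreeFiltration R x).symb (α + β).degree (orderedMonomial x (α + β))
        (orderedMonomial_mem R x (α + β)) =
      (degreeFiltration R x).symb α.degree (orderedMonomial x α) (orderedMonomial_mem R x α) *
      (degreeFiltration R x).symb β.degree (orderedMonomial x β) (orderedMonomial_mem R x β) := by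
  simp only [symb_orderedMonomial]
  rw [← List.prod_append, ← List.map_append]
  refine List.Perm.prod_eq' ?_ ?_
  · refine List.Perm.map _ (List.perm_iff_count.2 fun i => ?_)
    rw [List.count_append, count_sortedWord, count_sortedWord, count_sortedWord, Finsupp.add_apply]
  · exact List.pairwise_of_forall fun u v => hcomm u v

include hli hspan in
-- Independence of the ordered monomials, together with their spanning each filtration step in the
-- right degrees, makes leading terms well defined and bijective on the associated graded module.
theorem isPBW_of_orderedMonomials : IsPBW R x := by
  let e := LinearEquiv.ofBijective (grLeadingTerm hli hspan) (grLeadingTerm_bijective hli hspan)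
  have he : ∀ α, e.symm (MvPolynomial.monomial α 1) = (degreeFiltration R x).symb α.degree
      (orderedMonomial x α) (orderedMonomial_mem R x α) := fun α => by
    rw [LinearEquiv.symm_apply_eq]
    exact (grLeadingTerm_symb hli hspan α).symm
  refine ⟨e, fun d u => ?_, grLeadingTerm_symb hli hspan, fun hcomm => ?_⟩
  · change (grLeadingTerm hli hspan _).IsHomogeneous d
    rw [grLeadingTerm_of]
    exact pieceLeadingTerm_isHomogeneous hli hspan d u
  -- Multiplicativity is easier for the inverse, where it need only be checked on the monomial
  -- basis.
  · have key : ∀ f g, e.symm (f * g) = e.symm f * e.symm g := by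
      intro f g
      have h : (LinearMap.mul R (MvPolynomial (Fin n) R)).compr₂ e.symm.toLinearMap =
          (LinearMap.mul R (degreeFiltration R x).Gr).compl₁₂ e.symm.toLinearMap
            e.symm.toLinearMap := by
        refine (MvPolynomial.basisMonomials (Fin n) R).ext fun α =>
          (MvPolynomial.basisMonomials (Fin n) R).ext fun β => ?_
        simp only [MvPolynomial.coe_basisMonomials, LinearMap.compr₂_apply, LinearMap.mul_apply',
          LinearMap.compl₁₂_apply, LinearEquiv.coe_coe, MvPolynomial.monomial_mul, mul_one, he]
        exact symb_orderedMonomial_mul hcomm α β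
      exact LinearMap.congr_fun (LinearMap.congr_fun h f) g
    intro u v
    obtain ⟨f, rfl⟩ := e.symm.surjective u
    obtain ⟨g, rfl⟩ := e.symm.surjective v
    rw [← key]
    simp only [LinearEquiv.apply_symm_apply]

end Criterion

/-! ### Generic values of the parameter -/

section Generic

/-- Nakayama's lemma for the image of `N` in `M / P`, which is finitely generated and contained in
`h` times itself. -/
theorem exists_smul_mem_of_fg {R M : Type*} [CommRing R] [AddCommGroup M] [Module R M] {h : R}
    {N P : Submodule R M} (hN : N.FG) (hNP : ∀ x ∈ N, ∃ p ∈ P, ∃ y ∈ N, x = p + h • y) :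
    ∃ r, r - 1 ∈ Ideal.span {h} ∧ ∀ x ∈ N, r • x ∈ P := by
  obtain ⟨r, hr, H⟩ := Submodule.exists_sub_one_mem_and_smul_eq_zero_of_fg_of_le_smul
    (Ideal.span {h}) (N.map P.mkQ) (hN.map _) (by
      rintro _ ⟨x, hx, rfl⟩
      obtain ⟨p, hp, y, hy, rfl⟩ := hNP x hx
      rw [map_add, map_smul, Submodule.mkQ_apply, (Submodule.Quotient.mk_eq_zero P).2 hp, zero_add]
      exact Submodule.smul_mem_smul (Ideal.mem_span_singleton_self h) ⟨y, hy, rfl⟩)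
  refine ⟨r, hr, fun x hx => ?_⟩
  have := H _ ⟨x, hx, rfl⟩
  rwa [← map_smul, Submodule.mkQ_apply, Submodule.Quotient.mk_eq_zero] at this

variable {R : Type*} [CommRing R] {n : ℕ}

theorem wordSpan_fg (d : ℕ) : (wordSpan R (FreeAlgebra.ι R : Fin n → _) d).FG := by
  rw [wordSpan_ι]
  exact Submodule.fg_span ((List.finite_length_le _ _).image _)

theorem relSpan_shortPairs_fg (ρ : Fin n → Fin n → FreeAlgebra R (Fin n)) (m : ℕ) :
    (relSpan ρ (shortPairs n m)).FG := by
  refine Submodule.fg_span (Set.Finite.subset (Set.Finite.image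
    (fun p : (List (Fin n) × List (Fin n)) × (Fin n × Fin n) =>
      word R p.1.1 * ρ p.2.1 p.2.2 * word R p.1.2)
    ((((List.finite_length_le (Fin n) m).prod (List.finite_length_le (Fin n) m))).prod
      Set.finite_univ)) ?_)
  rintro _ ⟨u, v, a, b, huv, rfl⟩
  have h : u.length + v.length + 2 ≤ m := huv
  refine ⟨((u, v), (a, b)), ⟨⟨?_, ?_⟩, trivial⟩, rfl⟩
  · change u.length ≤ m
    omega
  · change v.length ≤ m
    omega

theorem relSpan_mono (ρ : Fin n → Fin n → FreeAlgebra R (Fin n))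
    {S S' : Set (List (Fin n) × List (Fin n))} (h : S ⊆ S') : relSpan ρ S ≤ relSpan ρ S' :=
  Submodule.span_mono fun _ ⟨u, v, a, b, huv, e⟩ => ⟨u, v, a, b, h huv, e⟩

theorem shortPairs_mono {m m' : ℕ} (h : m ≤ m') : shortPairs n m ⊆ shortPairs n m' :=
  fun p (hp : p.1.length + p.2.length + 2 ≤ m) => le_trans hp h

theorem word_mem_wordSpan {w : List (Fin n)} {d : ℕ} (hw : w.length ≤ d) :
    word R w ∈ wordSpan R (FreeAlgebra.ι R) d := Submodule.subset_span ⟨w, hw, rfl⟩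

theorem relSpan_shortPairs_le {ρ : Fin n → Fin n → FreeAlgebra R (Fin n)}
    (hρ : ∀ a b, ρ a b ∈ wordSpan R (FreeAlgebra.ι R) 2) (m : ℕ) :
    relSpan ρ (shortPairs n m) ≤ wordSpan R (FreeAlgebra.ι R) m := by
  refine Submodule.span_le.2 ?_
  rintro _ ⟨u, v, a, b, huv, rfl⟩
  have h : u.length + v.length + 2 ≤ m := huv
  exact wordSpan_mono R _ (show u.length + 2 + v.length ≤ m by omega)
    (mul_mem_wordSpan R _ (mul_mem_wordSpan R _ (word_mem_wordSpan le_rfl) (hρ a b))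
      (word_mem_wordSpan le_rfl))

/-- Words form a basis, so multiplication by `r` does not change the support. This passes the degree
bound from the correction terms to their quotients by `ħ`. -/
theorem mem_wordSpan_of_smul_mem [IsDomain R] {r : R} (hr : r ≠ 0) {d : ℕ}
    {t : FreeAlgebra R (Fin n)} (ht : r • t ∈ wordSpan R (FreeAlgebra.ι R) d) :
    t ∈ wordSpan R (FreeAlgebra.ι R) d := by
  have h : wordSpan R (FreeAlgebra.ι R) d = Submodule.span R
      (FreeAlgebra.basisFreeMonoid R (Fin n) '' {w | w.toList.length ≤ d}) := by
    rw [wordSpan_ι]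
    congr 1
    ext t
    constructor
    · rintro ⟨w, hw, rfl⟩
      exact ⟨FreeMonoid.ofList w, hw, basis_eq_word R _⟩
    · rintro ⟨w, hw, rfl⟩
      exact ⟨w.toList, hw, (basis_eq_word R _).symm⟩
  rw [h, Module.Basis.mem_span_image] at ht ⊢
  refine fun w hw => ht ?_
  rw [Finset.mem_coe, Finsupp.mem_support_iff] at hw ⊢
  rw [map_smul, Finsupp.smul_apply, smul_eq_mul]
  exact mul_ne_zero hr hw

theorem mapCoeff_mem_wordSpan {S : Type*} [CommRing S] (φ : R →+* S) {d : ℕ}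
    {t : FreeAlgebra R (Fin n)} (ht : t ∈ wordSpan R (FreeAlgebra.ι R) d) :
    mapCoeff φ n t ∈ wordSpan S (FreeAlgebra.ι S) d := by
  induction ht using Submodule.span_induction with
  | mem t ht =>
    obtain ⟨w, hw, rfl⟩ := ht
    change mapCoeff φ n (word R w) ∈ _
    rw [mapCoeff_word]
    exact word_mem_wordSpan hw
  | zero => rw [map_zero]; exact zero_mem _
  | add t u _ _ ht hu => rw [map_add]; exact add_mem ht hu
  | smul r t _ ht => rw [mapCoeff_smul]; exact Submodule.smul_mem _ _ ht

section Naturality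

variable {S : Type*} [CommRing S] (φ : R →+* S) {ρ : Fin n → Fin n → FreeAlgebra R (Fin n)}
  {ρ' : Fin n → Fin n → FreeAlgebra S (Fin n)} (hρ : ∀ a b, mapCoeff φ n (ρ a b) = ρ' a b)

include hρ

theorem mapCoeff_insertPath (a : Fin n) (s : List (Fin n)) :
    mapCoeff φ n (insertPath ρ a s) = insertPath ρ' a s := by
  induction s with
  | nil => exact map_zero _
  | cons b s ih =>
    rw [insertPath, insertPath]
    split_ifs
    · exact map_zero _
    · rw [map_add, map_mul, map_mul, ih, hρ, mapCoeff_word, mapCoeff_ι]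

theorem mapCoeff_sortPath (w : List (Fin n)) :
    mapCoeff φ n (sortPath ρ w) = sortPath ρ' w := by
  induction w with
  | nil => exact map_zero _
  | cons a w ih =>
    rw [sortPath, sortPath, map_add, map_mul, ih, mapCoeff_ι, mapCoeff_insertPath φ hρ]

theorem mapCoeff_sorting (t : FreeAlgebra R (Fin n)) :
    mapCoeff φ n (sorting ρ t) = sorting ρ' (mapCoeff φ n t) := by
  induction t using word_induction with
  | hw w => rw [mapCoeff_word, sorting_word, sorting_word, mapCoeff_sortPath φ hρ]
  | hz => simp
  | ha t u ht hu => simp only [map_add, ht, hu]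
  | hs r t ht => rw [map_smul, mapCoeff_smul, mapCoeff_smul, map_smul, ht]

end Naturality

theorem mapCoeff_orderedLift_abelianize {S : Type*} [CommRing S] (φ : R →+* S)
    (t : FreeAlgebra R (Fin n)) :
    mapCoeff φ n (orderedLift (FreeAlgebra.ι R) (abelianize R n t)) =
      orderedLift (FreeAlgebra.ι S) (abelianize S n (mapCoeff φ n t)) := by
  induction t using word_induction with
  | hw w =>
    rw [mapCoeff_word, orderedLift_abelianize_word, orderedLift_abelianize_word, mapCoeff_word]
  | hz => simp
  | ha t u ht hu => simp only [map_add, ht, hu]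
  | hs r t ht => simp only [map_smul, mapCoeff_smul, ht]

theorem map_orderedMonomial {A B : Type*} [Ring A] [Algebra R A] [Ring B] [Algebra R B]
    (f : A →ₐ[R] B) (x : Fin n → A) (α : Fin n →₀ ℕ) :
    f (orderedMonomial x α) = orderedMonomial (fun i => f (x i)) α := by
  rw [orderedMonomial_eq, orderedMonomial_eq, map_list_prod, List.map_map]
  rfl

theorem map_orderedLift {A B : Type*} [Ring A] [Algebra R A] [Ring B] [Algebra R B]
    (f : A →ₐ[R] B) (x : Fin n → A) (p : MvPolynomial (Fin n) R) :
    f (orderedLift x p) = orderedLift (fun i => f (x i)) p := by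
  rw [orderedLift_eq_sum, orderedLift_eq_sum, map_sum]
  exact Finset.sum_congr rfl fun α _ => by rw [map_smul, map_orderedMonomial]

/-- Both conditions of the criterion concern only words in the generators, so they carry over along
an injection. -/
theorem isPBW_of_injective {A B : Type*} [Ring A] [Algebra R A] [Ring B] [Algebra R B]
    (f : A →ₐ[R] B) (hf : Function.Injective f) {x : Fin n → A} {y : Fin n → B}
    (hli : Function.Injective (orderedLift x : MvPolynomial (Fin n) R →ₗ[R] A))
    (hspan : ∀ d, wordSpan R x d ≤ Submodule.span R (orderedMonomial x '' {α | α.degree ≤ d}))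
    (hy : ∀ i, f (x i) = y i) : IsPBW R y := by
  obtain rfl : (fun i => f (x i)) = y := funext hy
  refine isPBW_of_orderedMonomials (fun p q hpq => ?_) fun d => Submodule.span_le.2 ?_
  · rw [← map_orderedLift, ← map_orderedLift] at hpq
    exact hli (hf hpq)
  · rintro _ ⟨w, hw, rfl⟩
    have h := Submodule.mem_map_of_mem (f := f.toLinearMap)
      (hspan d (Submodule.subset_span ⟨w, hw, rfl⟩))
    rw [Submodule.map_span, Set.image_image] at h
    simp only [AlgHom.toLinearMap_apply, map_orderedMonomial, map_list_prod, List.map_map] at h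
    exact h

theorem orderedLift_mem_wordSpan {f : MvPolynomial (Fin n) R} {m : ℕ} (hf : f.totalDegree ≤ m) :
    orderedLift (FreeAlgebra.ι R) f ∈ wordSpan R (FreeAlgebra.ι R) m := by
  rw [orderedLift_eq_sum]
  refine Submodule.sum_mem _ fun α hα => Submodule.smul_mem _ _ ?_
  exact wordSpan_mono R _ ((MvPolynomial.le_totalDegree hα).trans hf) (orderedMonomial_mem R _ α)

end Generic

/-! ### Spanning and independence of ordered monomials outside a countable set -/

section Specialization

variable (N : ℕ) (Φ : ℕ → CyclicWord k 3)

theorem mapCoeff_relatorArray (a : k) (b c : Fin 3) :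
    mapCoeff (evalRingHom a) 3 (relatorArray (hbarPotential N Φ) b c) =
      relatorArray (potentialAt N Φ a) b c := by
  rw [relatorArray, relatorArray, crossArray, crossArray]
  split_ifs
  · exact mapCoeff_eval_relator N Φ a _
  · rw [map_neg, mapCoeff_eval_relator]
  · exact map_zero _

/-- Relations at `ħ = a` lift to `k[ħ]`. The bound `m` depends on the relation: cancellation may
hide long words, which is why independence has to use all `m` at once. -/
theorem exists_mapCoeff_eq (a : k) {t : FreeAlgebra k (Fin 3)}
    (ht : t ∈ relSpan (relatorArray (potentialAt N Φ a)) Set.univ) :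
    ∃ m, ∃ j ∈ relSpan (relatorArray (hbarPotential N Φ)) (shortPairs 3 m),
      mapCoeff (evalRingHom a) 3 j = t := by
  induction ht using Submodule.span_induction with
  | mem t ht =>
    obtain ⟨u, v, b, c, -, rfl⟩ := ht
    refine ⟨u.length + v.length + 2, word _ u * relatorArray (hbarPotential N Φ) b c * word _ v,
      Submodule.subset_span ⟨u, v, b, c, le_refl (u.length + v.length + 2), rfl⟩, ?_⟩
    rw [map_mul, map_mul, mapCoeff_word, mapCoeff_word, mapCoeff_relatorArray]
  | zero => exact ⟨0, 0, zero_mem _, map_zero _⟩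
  | add t u _ _ ht hu =>
    obtain ⟨m, i, hi, rfl⟩ := ht
    obtain ⟨m', j, hj, rfl⟩ := hu
    exact ⟨max m m', i + j, add_mem
      (relSpan_mono _ (shortPairs_mono (le_max_left _ _)) hi)
      (relSpan_mono _ (shortPairs_mono (le_max_right _ _)) hj), map_add _ _ _⟩
  | smul r t _ ht =>
    obtain ⟨m, i, hi, rfl⟩ := ht
    exact ⟨m, (C r : k[X]) • i, Submodule.smul_mem _ _ hi, by rw [mapCoeff_smul]; simp⟩

section Quadratic

variable (hΦ : ∀ i, cyclicDeriv k[X] i (hbarPotential N Φ) ∈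
  wordSpan k[X] (FreeAlgebra.ι k[X]) 2)

include hΦ

theorem hbarCorrection_mem (b c : Fin 3) :
    crossArray (hbarCorrection N Φ) b c ∈ wordSpan k[X] (FreeAlgebra.ι k[X]) 2 :=
  crossArray_mem _ (fun i => mem_wordSpan_of_smul_mem X_ne_zero (by
    rw [X_smul_hbarCorrection]
    exact hΦ i)) b c

theorem isDeformation_of_quadratic : IsDeformation (X : k[X]) (relatorArray (hbarPotential N Φ))
    (crossArray (hbarCorrection N Φ)) (wordSpan k[X] (FreeAlgebra.ι k[X]))
    (fun m => relSpan (relatorArray (hbarPotential N Φ)) (shortPairs 3 m)) :=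
  .of_quadratic (crossArray_eq (relator_hbar N Φ)) (hbarCorrection_mem N Φ hΦ)
    (crossArray_antisymm _) (crossArray_jacobi (sum_relator_comm _))

theorem relatorArray_mem (b c : Fin 3) : relatorArray (hbarPotential N Φ) b c ∈
    wordSpan k[X] (FreeAlgebra.ι k[X]) 2 := by
  refine crossArray_mem _ (fun i => ?_) b c
  have h : ∀ i j : Fin 3, FreeAlgebra.ι k[X] i * FreeAlgebra.ι k[X] j ∈
      wordSpan k[X] (FreeAlgebra.ι k[X]) 2 := fun i j =>
    Submodule.subset_span ⟨[i, j], by simp, by simp⟩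
  exact sub_mem (sub_mem (h _ _) (h _ _)) (hΦ i)

/-- The operator `sorting + orderedLift ∘ abelianize` is the identity modulo `ħ` on the finitely
generated module of words of length at most `m`. Nakayama's lemma makes it surjective up to a factor
`r`. -/
theorem exists_smul_eq_sorting_add (m : ℕ) : ∃ r : k[X], r ≠ 0 ∧
    ∀ t ∈ wordSpan k[X] (FreeAlgebra.ι k[X]) m, ∃ s ∈ wordSpan k[X] (FreeAlgebra.ι k[X]) m,
      r • t = sorting (relatorArray (hbarPotential N Φ)) s +
        orderedLift (FreeAlgebra.ι k[X]) (abelianize k[X] 3 s) := by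
  have D := isDeformation_of_quadratic N Φ hΦ
  obtain ⟨r, hr, H⟩ := exists_smul_mem_of_fg (h := (X : k[X]))
    (N := wordSpan k[X] (FreeAlgebra.ι k[X]) m)
    (P := (wordSpan k[X] (FreeAlgebra.ι k[X]) m).map
      (sorting (relatorArray (hbarPotential N Φ)) +
        orderedLift (FreeAlgebra.ι k[X]) ∘ₗ (abelianize k[X] 3).toLinearMap))
    (wordSpan_fg m) (by
      intro t ht
      obtain ⟨y, hy, e⟩ := D.sorting_add_orderedLift
        (V := wordSpan k[X] (FreeAlgebra.ι k[X]) m) (fun w hw => wordSpan_mono _ _ hw) ht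
      refine ⟨_, ⟨t, ht, rfl⟩, -y, neg_mem hy, ?_⟩
      rw [smul_neg, ← sub_eq_add_neg, eq_sub_iff_add_eq]
      exact e.symm)
  refine ⟨r, ?_, fun t ht => ?_⟩
  -- The factor is congruent to `1` modulo `ħ`, so it cannot be zero.
  · rintro rfl
    rw [Ideal.mem_span_singleton, X_dvd_iff] at hr
    simp at hr
  · obtain ⟨s, hs, e⟩ := H t ht
    exact ⟨s, hs, e.symm⟩

/-- The same argument on the relations of length at most `m`, with `exists_sorting_eq` supplying
preimages in the kernel of abelianization. -/
theorem exists_smul_eq_sorting (m : ℕ) : ∃ r : k[X], r ≠ 0 ∧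
    ∀ j ∈ relSpan (relatorArray (hbarPotential N Φ)) (shortPairs 3 m),
      ∃ c ∈ wordSpan k[X] (FreeAlgebra.ι k[X]) m, abelianize k[X] 3 c = 0 ∧
        r • j = sorting (relatorArray (hbarPotential N Φ)) c := by
  have D := isDeformation_of_quadratic N Φ hΦ
  obtain ⟨r, hr, H⟩ := exists_smul_mem_of_fg (h := (X : k[X]))
    (N := relSpan (relatorArray (hbarPotential N Φ)) (shortPairs 3 m))
    (P := (wordSpan k[X] (FreeAlgebra.ι k[X]) m ⊓
      LinearMap.ker (abelianize k[X] 3).toLinearMap).map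
        (sorting (relatorArray (hbarPotential N Φ))))
    (relSpan_shortPairs_fg _ m) (by
      intro j hj
      obtain ⟨c, hc, ⟨y, hy, e⟩, z, hz, f⟩ := D.exists_sorting_eq
        (U := relSpan (relatorArray (hbarPotential N Φ)) (shortPairs 3 m))
        (V := wordSpan k[X] (FreeAlgebra.ι k[X]) m) (crossArray_self _)
        (fun u v huv => relSpan_mono _ (shortPairs_mono huv))
        (fun u v huv => wordSpan_mono _ _ (by
          have h : u.length + v.length + 2 ≤ m := huv
          omega))
        (fun u b c => mul_mem_wordSpan _ _ (word_mem_wordSpan le_rfl)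
          (hbarCorrection_mem N Φ hΦ b c)) hj
      refine ⟨_, ⟨c, ⟨?_, hc⟩, rfl⟩, -y, neg_mem hy, ?_⟩
      -- The preimage keeps length at most `m` because it is `j + ħ z` with both terms of that
      -- length.
      · rw [f]
        exact add_mem (relSpan_shortPairs_le (relatorArray_mem N Φ hΦ) m hj)
          (Submodule.smul_mem _ _ hz)
      · rw [e, smul_neg]
        abel)
  refine ⟨r, ?_, fun j hj => ?_⟩
  · rintro rfl
    rw [Ideal.mem_span_singleton, X_dvd_iff] at hr
    simp at hr
  · obtain ⟨c, ⟨hc, hc0⟩, e⟩ := H j hj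
    exact ⟨c, hc, hc0, e.symm⟩

end Quadratic

variable {N Φ} {a : k}

theorem toPotential_mapCoeff_sorting (s : FreeAlgebra k[X] (Fin 3)) :
    toPotential (potentialAt N Φ a) (mapCoeff (evalRingHom a) 3
      (sorting (relatorArray (hbarPotential N Φ)) s)) = 0 := by
  have h : toPotential (hbarPotential N Φ)
      (sorting (relatorArray (hbarPotential N Φ)) s) = 0 := by
    rw [toPotential_eq_zero_iff]
    refine (isDeformation_hbar N Φ).sorting_mem (s := Set.univ) (fun _ _ => le_rfl) ?_
    rw [Set.image_univ, span_range_word]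
    trivial
  rw [← evalPotential_toPotential, h, map_zero]

theorem toPotential_orderedLift_mem {d : ℕ} {s : FreeAlgebra k (Fin 3)}
    (hs : s ∈ wordSpan k (FreeAlgebra.ι k) d) (Ψ : CyclicWord k 3) :
    toPotential Ψ (orderedLift (FreeAlgebra.ι k) (abelianize k 3 s)) ∈
      Submodule.span k (orderedMonomial (gen k Ψ) '' {α | α.degree ≤ d}) := by
  induction hs using Submodule.span_induction with
  | mem s hs =>
    obtain ⟨w, hw, rfl⟩ := hs
    change toPotential Ψ (orderedLift _ (abelianize k 3 (word k w))) ∈ _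
    rw [abelianize_word, orderedLift_monomial, map_orderedMonomial]
    refine Submodule.subset_span ⟨content w, ?_, rfl⟩
    change (content w).degree ≤ d
    rwa [degree_content]
  | zero => simp
  | add s t _ _ hs ht => simp only [map_add]; exact add_mem hs ht
  | smul r s _ hs => simp only [map_smul]; exact Submodule.smul_mem _ _ hs

/-- In `U(Φ(a))` the values of `sorting` vanish, so after division by `r(a)` a word becomes an
ordered lift. -/
theorem wordSpan_gen_le {d : ℕ} {r : k[X]} (hr : r.eval a ≠ 0)
    (H : ∀ t ∈ wordSpan k[X] (FreeAlgebra.ι k[X]) d,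
      ∃ s ∈ wordSpan k[X] (FreeAlgebra.ι k[X]) d,
      r • t = sorting (relatorArray (hbarPotential N Φ)) s +
        orderedLift (FreeAlgebra.ι k[X]) (abelianize k[X] 3 s)) :
    wordSpan k (gen k (potentialAt N Φ a)) d ≤
      Submodule.span k (orderedMonomial (gen k (potentialAt N Φ a)) '' {α | α.degree ≤ d}) := by
  refine Submodule.span_le.2 ?_
  rintro _ ⟨w, hw, rfl⟩
  obtain ⟨s, hs, e⟩ := H (word k[X] w) (word_mem_wordSpan hw)
  have e' := congrArg (fun t => toPotential (potentialAt N Φ a) (mapCoeff (evalRingHom a) 3 t)) e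
  simp only [map_add] at e'
  rw [toPotential_mapCoeff_sorting, zero_add, mapCoeff_smul, map_smul, mapCoeff_word,
    toPotential_word, mapCoeff_orderedLift_abelianize] at e'
  refine (Submodule.smul_mem_iff _ hr).1 ?_
  rw [← coe_evalRingHom, e']
  exact toPotential_orderedLift_mem (mapCoeff_mem_wordSpan _ hs) _

/-- At `ħ = a` the operator is an endomorphism of a finite-dimensional space. It is surjective since
`r(a) ≠ 0`, hence injective. -/
theorem eq_of_sorting_add_eq {m : ℕ} {r : k[X]} (hr : r.eval a ≠ 0)
    (H : ∀ t ∈ wordSpan k[X] (FreeAlgebra.ι k[X]) m,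
      ∃ s ∈ wordSpan k[X] (FreeAlgebra.ι k[X]) m,
      r • t = sorting (relatorArray (hbarPotential N Φ)) s +
        orderedLift (FreeAlgebra.ι k[X]) (abelianize k[X] 3 s))
    (hL : ∀ t ∈ wordSpan k[X] (FreeAlgebra.ι k[X]) m,
      sorting (relatorArray (hbarPotential N Φ)) t +
        orderedLift (FreeAlgebra.ι k[X]) (abelianize k[X] 3 t) ∈
          wordSpan k[X] (FreeAlgebra.ι k[X]) m)
    {t u : FreeAlgebra k (Fin 3)} (ht : t ∈ wordSpan k (FreeAlgebra.ι k) m)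
    (hu : u ∈ wordSpan k (FreeAlgebra.ι k) m)
    (htu : sorting (relatorArray (potentialAt N Φ a)) t +
        orderedLift (FreeAlgebra.ι k) (abelianize k 3 t) =
      sorting (relatorArray (potentialAt N Φ a)) u +
        orderedLift (FreeAlgebra.ι k) (abelianize k 3 u)) : t = u := by
  let L : FreeAlgebra k (Fin 3) →ₗ[k] FreeAlgebra k (Fin 3) :=
    sorting (relatorArray (potentialAt N Φ a)) +
      orderedLift (FreeAlgebra.ι k) ∘ₗ (abelianize k 3).toLinearMap
  have hev : ∀ s, mapCoeff (evalRingHom a) 3 (sorting (relatorArray (hbarPotential N Φ)) s +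
        orderedLift (FreeAlgebra.ι k[X]) (abelianize k[X] 3 s)) =
      L (mapCoeff (evalRingHom a) 3 s) := fun s => by
    rw [map_add, mapCoeff_sorting _ (mapCoeff_relatorArray N Φ a), mapCoeff_orderedLift_abelianize]
    rfl
  have hmaps : ∀ s ∈ wordSpan k (FreeAlgebra.ι k) m, L s ∈ wordSpan k (FreeAlgebra.ι k) m := by
    change wordSpan k (FreeAlgebra.ι k) m ≤ (wordSpan k (FreeAlgebra.ι k) m).comap L
    refine Submodule.span_le.2 ?_
    rintro _ ⟨w, hw, rfl⟩
    have h := mapCoeff_mem_wordSpan (evalRingHom a) (hL (word k[X] w) (word_mem_wordSpan hw))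
    rwa [hev, mapCoeff_word] at h
  have : FiniteDimensional k (wordSpan k (FreeAlgebra.ι k : Fin 3 → _) m) :=
    Module.Finite.of_fg (wordSpan_fg m)
  have hsurj : Function.Surjective (L.restrict hmaps) := by
    have hle : wordSpan k (FreeAlgebra.ι k) m ≤ (wordSpan k (FreeAlgebra.ι k) m).map L := by
      refine Submodule.span_le.2 ?_
      rintro _ ⟨w, hw, rfl⟩
      obtain ⟨s, hs, e⟩ := H (word k[X] w) (word_mem_wordSpan hw)
      have e' := congrArg (mapCoeff (evalRingHom a) 3) e
      rw [hev, mapCoeff_smul, mapCoeff_word] at e'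
      exact (Submodule.smul_mem_iff _ hr).1 ⟨_, mapCoeff_mem_wordSpan _ hs, e'.symm⟩
    rintro ⟨s, hs⟩
    obtain ⟨s', hs', e⟩ := hle hs
    exact ⟨⟨s', hs'⟩, Subtype.ext e⟩
  have hinj := LinearMap.injective_iff_surjective.2 hsurj
  exact congrArg Subtype.val (@hinj ⟨t, ht⟩ ⟨u, hu⟩ (Subtype.ext htu))

variable (N Φ) in
-- For independence, let `f` have ordered lift zero in `U(Φ(a))`. Then `p(a)` times the lift of `f`
-- is `sorting c` for some `c` with zero abelianization. Injectivity of the specialized operator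
-- identifies `c` with the lift of `p(a) f`, and abelianizing gives `p(a) f = 0`.
theorem exists_isPBW_gen (hΦ : ∀ i, cyclicDeriv k[X] i (hbarPotential N Φ) ∈
      wordSpan k[X] (FreeAlgebra.ι k[X]) 2) :
    ∃ S : Set k, S.Countable ∧ ∀ a ∉ S,
      Function.Injective (orderedLift (gen k (potentialAt N Φ a)) :
        MvPolynomial (Fin 3) k →ₗ[k] PotentialAlgebra k (potentialAt N Φ a)) ∧
      ∀ d, wordSpan k (gen k (potentialAt N Φ a)) d ≤ Submodule.span k
        (orderedMonomial (gen k (potentialAt N Φ a)) '' {α | α.degree ≤ d}) := by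
  choose r hr0 hr using exists_smul_eq_sorting_add N Φ hΦ
  choose p hp0 hp using exists_smul_eq_sorting N Φ hΦ
  -- For each length bound `m` only the finitely many roots of a nonzero polynomial are excluded.
  refine ⟨⋃ m, {a | (r m * p m).IsRoot a}, Set.countable_iUnion fun m =>
    (finite_setOfPred_isRoot (mul_ne_zero (hr0 m) (hp0 m))).countable, fun a ha => ?_⟩
  have ha' : ∀ m, (r m).eval a ≠ 0 ∧ (p m).eval a ≠ 0 := fun m => by
    rw [← not_or, ← mul_eq_zero, ← eval_mul]
    exact fun h => ha (Set.mem_iUnion.2 ⟨m, h⟩)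
  refine ⟨(injective_iff_map_eq_zero _).2 fun f hf => ?_,
    fun d => wordSpan_gen_le (ha' d).1 (hr d)⟩
  have hf' : toPotential (potentialAt N Φ a) (orderedLift (FreeAlgebra.ι k) f) = 0 :=
    (map_orderedLift _ _ _).trans hf
  rw [toPotential_eq_zero_iff] at hf'
  obtain ⟨m₀, j, hj, e⟩ := exists_mapCoeff_eq N Φ a hf'
  -- The bound must accommodate both the lifted relation and the ordered lift of `f`.
  obtain ⟨c, hc, hc0, e'⟩ := hp (max m₀ f.totalDegree) j
    (relSpan_mono _ (shortPairs_mono (le_max_left _ _)) hj)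
  generalize hm : max m₀ f.totalDegree = m at hc e'
  replace e' := congrArg (mapCoeff (evalRingHom a) 3) e'
  rw [mapCoeff_smul, e, mapCoeff_sorting _ (mapCoeff_relatorArray N Φ a)] at e'
  have hc0' : abelianize k 3 (mapCoeff (evalRingHom a) 3 c) = 0 := by
    rw [abelianize_mapCoeff, hc0, map_zero]
  have key : mapCoeff (evalRingHom a) 3 c =
      orderedLift (FreeAlgebra.ι k) ((p m).eval a • f) := by
    refine eq_of_sorting_add_eq (ha' m).1 (hr m) (fun t ht => ?_) (mapCoeff_mem_wordSpan _ hc)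
      (orderedLift_mem_wordSpan ((MvPolynomial.totalDegree_smul_le _ _).trans
        (hm ▸ le_max_right _ _))) ?_
    · obtain ⟨y, hy, e⟩ := (isDeformation_of_quadratic N Φ hΦ).sorting_add_orderedLift
        (V := wordSpan k[X] (FreeAlgebra.ι k[X]) m) (fun w hw => wordSpan_mono _ _ hw) ht
      rw [e]
      exact add_mem ht (Submodule.smul_mem _ _ hy)
    -- On `c` only the `sorting` summand survives. On the lift of `p(a) f` only the ordered lift
    -- survives, since `sorting` kills sorted words.
    · rw [hc0', map_zero, add_zero, sorting_orderedLift, zero_add, abelianize_orderedLift, ← e',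
        map_smul, coe_evalRingHom]
  rw [key, abelianize_orderedLift] at hc0'
  exact (smul_eq_zero.1 hc0').resolve_left (ha' m).2

variable (N Φ) in
theorem exists_isPBW_specGen (hΦ : ∀ i, cyclicDeriv k[X] i (hbarPotential N Φ) ∈
      wordSpan k[X] (FreeAlgebra.ι k[X]) 2) :
    ∃ S : Set k, S.Countable ∧ ∀ a ∉ S, IsPBW k (specGen N Φ a) := by
  obtain ⟨S, hS, H⟩ := exists_isPBW_gen N Φ hΦ
  refine ⟨S, hS, fun a ha => ?_⟩
  obtain ⟨hinj, hspan⟩ := H a ha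
  exact isPBW_of_injective (toSpecialization N Φ a) (toSpecialization_injective N Φ a) hinj hspan
    (toSpecialization_gen N Φ a)

end Specialization

end CyclicPotential

end

theorem mainTheorem3 {k : Type*} [Field k] (N : ℕ) (Φ : ℕ → CyclicPotential.CyclicWord k 3) :
    CyclicPotential.koszulD k[X] (CyclicPotential.hbarPotential N Φ)
        (CyclicPotential.koszulXi k[X]) = 0 ∧
    CyclicPotential.IsDescendingPBW k
        (CyclicPotential.gen k[X] (CyclicPotential.hbarPotential N Φ)) ∧
    (∀ a : k, ∃ e : CyclicPotential.Specialization N Φ a ≃ₐ[k]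
          CyclicPotential.PotentialAlgebra k (CyclicPotential.potentialAt N Φ a),
        ∀ i, e (CyclicPotential.specGen N Φ a i) =
          CyclicPotential.gen k (CyclicPotential.potentialAt N Φ a) i) ∧
    ((∀ i, CyclicPotential.cyclicDeriv k[X] i (CyclicPotential.hbarPotential N Φ) ∈
          CyclicPotential.wordSpan k[X] (FreeAlgebra.ι k[X]) 2) →
      ∃ S : Set k, S.Countable ∧
        ∀ a ∉ S, CyclicPotential.IsPBW k (CyclicPotential.specGen N Φ a)) :=
  ⟨CyclicPotential.koszulD_koszulXi _, CyclicPotential.isDescendingPBW_gen N Φ,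
    fun a => ⟨CyclicPotential.specializationEquiv N Φ a,
      CyclicPotential.specializationEquiv_specGen N Φ a⟩,
    CyclicPotential.exists_isPBW_specGen N Φ⟩
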